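/- **Market and algorithm.** Consider a linear Arrow–Debreu market with $N$ agents and $N$ goods in which agent $b_i$ owns exactly one unit of good $g_i$ and nobody else owns any of $g_i$; let $u_{ij}\in\mathbb Z_{\ge 0}$ be the utility of $b_i$ for one unit of $g_j$. For prices $p$, the equality network $N_p$ has an edge $(s,b_i)$ of capacity $p_i$ for every $i$, an edge $(g_j,t)$ of capacity $p_j$ for every $j$, and an edge $(b_i,g_j)$ of infinite capacity whenever $u_{ij}/p_j=\max_k u_{ik}/p_k$. The surplus of $b_i$ under a flow $f$ is $r_f(b_i)=p_i-\sum_j f_{ij}$, and a balanced flow is a valid flow in $N_p$ that minimizes $\|r_f\|_2$. The Duan–Mehlhorn algorithm starts with all prices equal to $1$ and, as long as $\|r_f\|_2>\varepsilon$ for a balanced flow $f$ in $N_p$, where $\varepsilon=1/(8N^{4N}\hat U^{3N})$ with $\hat U=\max_{i,j}u_{ij}$, executes the following iteration. 1. Sort the agents by decreasing surplus, $r_f(b_1)\ge\dots\ge r_f(b_N)$. Let $\ell$ be minimal with $r_f(b_\ell)>(1+\frac1N)\,r_f(b_{\ell+1})$ (and $\ell=N$ if there is none), let $S=\{b_1,\dots,b_\ell\}$,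 and let $\Gamma(S)$ be the set of goods adjacent to $S$ in $N_p$. 2. Multiply the prices of the goods in $\Gamma(S)$ by $x=\min(x_{\mathrm{eq}},x_{23},x_{24},x_{13},x_2,x_{\max})$, with $x_{\max}=1+\frac1{RN^3}$ and $R=8e^2$. Here $x_{\mathrm{eq}}$ is the minimum of $\frac{u_{ij}}{p_j}\cdot\frac{p_k}{u_{ik}}$ over $b_i\in S$, edges $(b_i,g_j)$ of $N_p$ and $g_k\notin\Gamma(S)$ with $u_{ik}>0$. An agent of $S$ has type 1 if its good is in $\Gamma(S)$ and type 2 otherwise; an agent outside $S$ has type 3 if its good is in $\Gamma(S)$ and type 4 otherwise. When the prices of, and the flows into, the goods of $\Gamma(S)$ are multiplied by a factor $x>1$, $x_{ab}$ is the minimal such factor at which some agent of type $a$ and some agent of type $b$ have equal surplus, and $x_2$ is the minimal such factor at which some type-2 agent has surplus $0$. Minima over empty sets are ignored. **The instance $I'_n$ with parameter $U$.** For every prime $i<n^{1/3}$ and every $1\le j<i$ there is a block $\mathit{block}_{i,j}$ consisting of agents $b_1,\dots,b_i$ and goods $g_1,\dots,g_i$; there is one further block $\mathit{block}_{n,n}$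 with agents $b_1,\dots,b_n$ and goods $g_1,\dots,g_n$. In every block agent $b_k$ owns good $g_k$. The goods $g_1,\dots,g_j$ of $\mathit{block}_{i,j}$ are its high-demand goods, the others its low-demand goods. Let $\pi_1,\pi_2,\dots$ be the blocks $\mathit{block}_{i,j}$ sorted in decreasing order of $\frac{i-j}{i}$. All utilities are $0$ except for the following: * every agent of $\mathit{block}_{i,j}$ has utility $2U$ for every high-demand good of the same block; * every owner of a high-demand good of $\pi_1$ has utility $2$ for every low-demand good of every $\pi_k$ (including $\pi_1$), and utility $1$ for every good of $\mathit{block}_{n,n}$; * every owner of a high-demand good of $\pi_{k+1}$ has utility $2$ for every high-demand good of $\pi_k$; * agent $b_k$ of $\mathit{block}_{n,n}$ has utility $U$ for good $g_k$ of $\mathit{block}_{n,n}$ and utility $1$ for good $g_1$ of $\pi_1$. **Theorem.** The number of iterations that the Duan–Mehlhorn algorithm executes on $I'_n$ is $\Omega\!\left(\frac{n^{4+1/3}\log U}{\log^4 n}\right)$. That is, there are a constant $c>0$ and an $n_0$ such that for all integers $n\ge n_0$ and $U\ge 1$ every run of the algorithm on $I'_n$ (whatever balanced flows it chooses) executes at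 least $c\,n^{4+1/3}\log U/\log^4 n$ iterations. -/

import Mathlib

/-! Linear Arrow–Debreu markets in which agent `i` is the sole owner of one unit of good `i`; the
index type `ι` serves both for the agents and for the goods.  The utility matrix is integral, `u i j`
being the utility of agent `i` for one unit of good `j`, and the budget of agent `i` at prices `p` is
`p i`. -/

namespace DuanMehlhorn

noncomputable section

open scoped ENNReal

section Algorithm

variable {ι : Type*} [Fintype ι]

/-- `(i, j)` is an edge of the equality network at prices `p`: good `j` gives agent `i` the maximum
utility per unit of money. -/
def EqualityEdge (u : ι → ι → ℕ) (p : ι → ℝ) (i j : ι) : Prop :=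
  ∀ k, (u i k : ℝ) / p k ≤ (u i j : ℝ) / p j

/-- The goods adjacent in the equality network to some agent of `S`. -/
def neighbors (u : ι → ι → ℕ) (p : ι → ℝ) (S : Set ι) : Set ι :=
  {j | ∃ i ∈ S, EqualityEdge u p i j}

/-- A valid flow in the equality network.  Edge `(source, i)` has capacity `p i`, edge `(j, sink)` has
capacity `p j`, equality edges have infinite capacity; the flow on the former two kinds of edges is
determined by conservation, so that a flow is given by its values `f i j` between agents and goods. -/
structure IsFlow (u : ι → ι → ℕ) (p : ι → ℝ) (f : ι → ι → ℝ) : Prop where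
  nonneg : ∀ i j, 0 ≤ f i j
  support : ∀ i j, ¬ EqualityEdge u p i j → f i j = 0
  budget : ∀ i, ∑ j, f i j ≤ p i
  supply : ∀ j, ∑ i, f i j ≤ p j

/-- The surplus of agent `i`: the money that it does not spend. -/
def surplus (p : ι → ℝ) (f : ι → ι → ℝ) (i : ι) : ℝ := p i - ∑ j, f i j

/-- The Euclidean norm of the surplus vector of the agents. -/
def surplusNorm (p : ι → ℝ) (f : ι → ι → ℝ) : ℝ := Real.sqrt (∑ i, surplus p f i ^ 2)

/-- A balanced flow: a valid flow whose surplus vector has minimum norm. -/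
def IsBalanced (u : ι → ι → ℕ) (p : ι → ℝ) (f : ι → ι → ℝ) : Prop :=
  IsFlow u p f ∧ ∀ g, IsFlow u p g → surplusNorm p f ≤ surplusNorm p g

/-- The set `S` of high-surplus agents for a surplus vector `r`, with `N` the number of agents.
Sort the agents by decreasing surplus, `r b₁ ≥ … ≥ r b_N`, let `ℓ` be minimal with
`r b_ℓ > (1 + 1/N) r b_{ℓ+1}`, and `ℓ = N` if there is no such `ℓ`; then `S = {b₁, …, b_ℓ}`.
In other words: call `i` a gap agent if `r i > (1 + 1/N) r j` for all agents `j` of smaller surplus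
(an agent of minimum surplus is one); `S` consists of the agents whose surplus is at least that of
every gap agent. -/
def highSurplus (r : ι → ℝ) : Set ι :=
  {k | ∀ i, (∀ j, r j < r i → (1 + 1 / (Fintype.card ι : ℝ)) * r j < r i) → r i ≤ r k}

open Classical in
/-- The prices of the goods in `G` are multiplied by `x`. -/
def scalePrice (G : Set ι) (x : ℝ) (p : ι → ℝ) (j : ι) : ℝ :=
  if j ∈ G then x * p j else p j

open Classical in
/-- The flow into the goods in `G` is multiplied by `x`. -/
def scaleFlow (G : Set ι) (x : ℝ) (f : ι → ι → ℝ) (i j : ι) : ℝ :=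
  if j ∈ G then x * f i j else f i j

/-- The surplus of agent `i` after prices and flow have been scaled by `x` on `G`. -/
def newSurplus (G : Set ι) (p : ι → ℝ) (f : ι → ι → ℝ) (x : ℝ) (i : ι) : ℝ :=
  surplus (scalePrice G x p) (scaleFlow G x f) i

/-- The factors at which some agent of `S` gets a new equality edge to a good outside of `G`. -/
def edgeFactors (u : ι → ι → ℕ) (p : ι → ℝ) (S G : Set ι) : Set ℝ :=
  {x | ∃ i ∈ S, ∃ j, EqualityEdge u p i j ∧ ∃ k, k ∉ G ∧ 0 < u i k ∧
    x = ((u i j : ℝ) / p j) * (p k / (u i k : ℝ))}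

/-- The factors `x > 1` at which some agent of `T` and some agent of `T'` have equal new surplus. -/
def meetFactors (p : ι → ℝ) (f : ι → ι → ℝ) (G T T' : Set ι) : Set ℝ :=
  {x | 1 < x ∧ ∃ i ∈ T, ∃ j ∈ T', newSurplus G p f x i = newSurplus G p f x j}

/-- The factors `x > 1` at which the new surplus of some agent of `T` is zero. -/
def zeroFactors (p : ι → ℝ) (f : ι → ι → ℝ) (G T : Set ι) : Set ℝ :=
  {x | 1 < x ∧ ∃ i ∈ T, newSurplus G p f x i = 0}

/-- The cap `x_max = 1 + 1/(R N³)`, with `R = 8 e²` and `N` the number of agents. -/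
def xMax (ι : Type*) [Fintype ι] : ℝ :=
  1 + 1 / (8 * Real.exp 1 ^ 2 * (Fintype.card ι : ℝ) ^ 3)

/-- The factor `x = min (x_eq, x_23, x_24, x_13, x_2, x_max)` for the set `S` and its neighborhood
`G`.  An agent of `S` is of type 1 if its good lies in `G` and of type 2 otherwise; an agent outside of
`S` is of type 3 if its good lies in `G` and of type 4 otherwise.  A minimum over the empty set does
not contribute. -/
def updateFactor (u : ι → ι → ℕ) (p : ι → ℝ) (f : ι → ι → ℝ) (S G : Set ι) : ℝ :=
  sInf ({xMax ι} ∪ edgeFactors u p S G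
    ∪ meetFactors p f G (S \ G) (G \ S)
    ∪ meetFactors p f G (S \ G) (S ∪ G)ᶜ
    ∪ meetFactors p f G (S ∩ G) (G \ S)
    ∪ zeroFactors p f G (S \ G))

/-- The price update of one iteration, for the balanced flow `f`. -/
def updatePrice (u : ι → ι → ℕ) (p : ι → ℝ) (f : ι → ι → ℝ) : ι → ℝ :=
  let S := highSurplus (surplus p f)
  let G := neighbors u p S
  scalePrice G (updateFactor u p f S G) p

/-- The maximum utility. -/
def maxUtility (u : ι → ι → ℕ) : ℕ :=
  Finset.univ.sup fun i => Finset.univ.sup fun j => u i j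

/-- The termination threshold `ε = 1 / (8 N^(4N) U^(3N))`, where `N` is the number of agents and `U`
the maximum utility. -/
def threshold (u : ι → ι → ℕ) : ℝ :=
  1 / (8 * (Fintype.card ι : ℝ) ^ (4 * Fintype.card ι)
    * (maxUtility u : ℝ) ^ (3 * Fintype.card ι))

/-- A run of the main loop of the algorithm: `p t` are the prices after `t` iterations and `f t` is a
balanced flow at these prices.  All prices are initially `1`, and an iteration is executed as long
as the norm of the surplus vector exceeds the threshold.  (Nothing is demanded of the prices after the
loop has been left.) -/
structure IsRun (u : ι → ι → ℕ) (p : ℕ → ι → ℝ) (f : ℕ → ι → ι → ℝ) : Prop where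
  init : ∀ j, p 0 j = 1
  balanced : ∀ t, IsBalanced u (p t) (f t)
  step : ∀ t, threshold u < surplusNorm (p t) (f t) → p (t + 1) = updatePrice u (p t) (f t)

/-- The number of iterations that a run executes (`⊤` if it never leaves the loop). -/
def iterations (u : ι → ι → ℕ) (p : ℕ → ι → ℝ) (f : ℕ → ι → ι → ℝ) : ℕ∞ :=
  ⨅ t ∈ {t : ℕ | surplusNorm (p t) (f t) ≤ threshold u}, (t : ℕ∞)

/-! Balanced flows, and hence runs, exist. -/

theorem exists_isBalanced (u : ι → ι → ℕ) (p : ι → ℝ) (hp : ∀ j, 0 ≤ p j) :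
    ∃ f, IsBalanced u p f := by
  classical
  let K : Set (ι → ι → ℝ) := {f | IsFlow u p f}
  have hK : K = (Set.univ.pi fun i => Set.univ.pi fun _ : ι => Set.Icc 0 (p i)) ∩
      {f | (∀ i j, ¬ EqualityEdge u p i j → f i j = 0) ∧ (∀ i, ∑ j, f i j ≤ p i) ∧
        ∀ j, ∑ i, f i j ≤ p j} := by
    ext f
    constructor
    · intro h
      refine ⟨fun i _ j _ => ⟨h.nonneg i j, ?_⟩, h.support, h.budget, h.supply⟩
      exact (Finset.single_le_sum (fun k _ => h.nonneg i k) (Finset.mem_univ j)).trans (h.budget i)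
    · rintro ⟨h1, h2, h3, h4⟩
      exact ⟨fun i j => (h1 i trivial j trivial).1, h2, h3, h4⟩
  have hc : IsCompact K := by
    rw [hK]
    refine IsCompact.inter_right ?_ ?_
    · exact isCompact_univ_pi fun i => isCompact_univ_pi fun _ => isCompact_Icc
    · have he : {f : ι → ι → ℝ | (∀ i j, ¬ EqualityEdge u p i j → f i j = 0) ∧
          (∀ i, ∑ j, f i j ≤ p i) ∧ ∀ j, ∑ i, f i j ≤ p j} =
          (⋂ i, ⋂ j, ⋂ _ : ¬ EqualityEdge u p i j, {f : ι → ι → ℝ | f i j = 0}) ∩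
            ((⋂ i, {f : ι → ι → ℝ | ∑ j, f i j ≤ p i}) ∩
              ⋂ j, {f : ι → ι → ℝ | ∑ i, f i j ≤ p j}) := by
        ext f
        simp only [Set.mem_ofPred_eq, Set.mem_inter_iff, Set.mem_iInter]
      rw [he]
      refine IsClosed.inter ?_ (IsClosed.inter ?_ ?_)
      · exact isClosed_iInter fun i => isClosed_iInter fun j => isClosed_iInter fun _ =>
          isClosed_eq (by fun_prop) continuous_const
      · exact isClosed_iInter fun i => isClosed_le (by fun_prop) continuous_const
      · exact isClosed_iInter fun j => isClosed_le (by fun_prop) continuous_const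
  have h0 : K.Nonempty :=
    ⟨0, ⟨fun _ _ => le_rfl, fun _ _ _ => rfl, fun i => by simpa using hp i,
      fun j => by simpa using hp j⟩⟩
  have hcont : Continuous fun f : ι → ι → ℝ => surplusNorm p f := by
    unfold surplusNorm surplus
    fun_prop
  obtain ⟨f, hf, hmin⟩ := hc.exists_isMinOn h0 hcont.continuousOn
  exact ⟨f, hf, fun g hg => hmin hg⟩

theorem updatePrice_nonneg (u : ι → ι → ℕ) (p : ι → ℝ) (f : ι → ι → ℝ) (hp : ∀ j, 0 ≤ p j) (j : ι) :
    0 ≤ updatePrice u p f j := by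
  unfold updatePrice scalePrice
  split_ifs
  · refine mul_nonneg (Real.sInf_nonneg ?_) (hp j)
    rintro x (((((rfl | h) | h) | h) | h) | h)
    · unfold xMax
      positivity
    · obtain ⟨i, -, k, -, l, -, -, rfl⟩ := h
      have := hp k
      have := hp l
      positivity
    all_goals exact zero_le_one.trans h.1.le
  · exact hp j

theorem exists_isRun (u : ι → ι → ℕ) : ∃ p f, IsRun u p f := by
  choose F hF using fun q : {p : ι → ℝ // ∀ j, 0 ≤ p j} => exists_isBalanced u q.1 q.2
  let P : ℕ → {p : ι → ℝ // ∀ j, 0 ≤ p j} := fun t => Nat.rec ⟨1, fun _ => zero_le_one⟩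
    (fun _ q => ⟨updatePrice u q.1 (F q), updatePrice_nonneg u q.1 (F q) q.2⟩) t
  exact ⟨fun t => (P t).1, fun t => F (P t), fun _ => rfl, fun t => hF (P t), fun _ _ => rfl⟩

end Algorithm

/-! The block instance. -/

/-- The blocks of the instance, as the set of the pairs `(i, j)` with `i` prime, `i < n^(1/3)` and
`1 ≤ j < i`. -/
def blocks (n : ℕ) : Finset (ℕ × ℕ) :=
  (Finset.range n ×ˢ Finset.range n).filter fun b =>
    b.1.Prime ∧ (b.1 : ℝ) < (n : ℝ) ^ (1 / 3 : ℝ) ∧ 1 ≤ b.2 ∧ b.2 < b.1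

/-- The ratio `(i - j) / i` of the block `(i, j)`. -/
def ratio (b : ℕ × ℕ) : ℚ := ((b.1 : ℚ) - b.2) / b.1

/-- The position, counted from `0`, of a block in the sequence of all blocks sorted in decreasing
order of their ratios. -/
def position (n : ℕ) (b : ℕ × ℕ) : ℕ := ((blocks n).filter fun a => ratio b < ratio a).card

/-- The agents (and the goods that they own): block `(i, j)` has `i` of them, numbered from `0`, and
the last block has `n` of them. -/
abbrev Agent (n : ℕ) : Type := (Σ b : {b : ℕ × ℕ // b ∈ blocks n}, Fin b.1.1) ⊕ Fin n

/-- The high-demand goods of block `(i, j)` are its first `j` goods. -/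
def IsHigh {n : ℕ} (a : Σ b : {b : ℕ × ℕ // b ∈ blocks n}, Fin b.1.1) : Prop :=
  a.2.1 < a.1.1.2

open Classical in
/-- The utilities of the block instance. -/
def utility (n U : ℕ) : Agent n → Agent n → ℕ
  | .inl a, .inl g =>
      if a.1 = g.1 ∧ IsHigh g then 2 * U
      else if position n a.1 = 0 ∧ IsHigh a ∧ ¬ IsHigh g then 2
      else if position n a.1 = position n g.1 + 1 ∧ IsHigh a ∧ IsHigh g then 2
      else 0
  | .inl a, .inr _ => if position n a.1 = 0 ∧ IsHigh a then 1 else 0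
  | .inr _, .inl g => if position n g.1 = 0 ∧ g.2.1 = 0 then 1 else 0
  | .inr k, .inr l => if k = l then U else 0

end

end DuanMehlhorn

/-! Order the blocks by decreasing ratio, positions `0, 1, …, m - 1`. For `U ≥ 2`, throughout the
run all high-demand goods of the block at position `k` share one price `P k`, and every other good
still costs `1`. Call the block below target while `P k < U ^ (k + 1)`. Such a block trades only
within itself, so a balanced flow gives each of its agents the surplus `(i - j) / i`
(`surplus_eq_ratio`). This exceeds the termination threshold, so at termination every `log (P k)`
has climbed from `0` to at least `(k + 1) log U`, in total at least about `m² / 2 · log U`.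

An iteration multiplies prices by at most `xMax`, whose logarithm is at most `1 / n³`. It remains to
see that blocks rise essentially one at a time. Ratios of consecutive blocks differ by a factor
above `1 + 1 / N` (`ratio_gap`), so `highSurplus` can contain the agents of two consecutive blocks
below target only if some agent has a surplus strictly in between. That agent belongs to a block
that has reached its target, and through it the price of a block that has reached its target rises.
One such rising block provides at most three surplus values: those of its low-demand owners, of its
high-demand owners and of the high-demand owners of the next block. Hence at most `1 + 3 b` blocks
below target rise when `b` others rise (`card_rises_le`).

The potential therefore counts `log (P k)` up to its target and subtracts three times the excess; it
grows by at most `log xMax` per iteration (`Inv.step`). The excess is at most `log N` per block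
(`price_le_pow`), since the high-demand goods can always be sold out and budgets are limited. So
there are at least `n³ (m² / 2 · log U - 3 m log N)` iterations, and Chebyshev's bound gives `m` of
order at least `n^(2/3) / log² n`. -/

namespace DuanMehlhorn

/-! ### Balanced flows, high-surplus sets and price updates in an arbitrary market -/

section General

variable {ι : Type*} [Fintype ι] {u : ι → ι → ℕ} {p : ι → ℝ} {f : ι → ι → ℝ}

theorem IsFlow.surplus_nonneg (h : IsFlow u p f) (i : ι) : 0 ≤ surplus p f i :=
  sub_nonneg.2 (h.budget i)

theorem IsBalanced.sum_sq_le (h : IsBalanced u p f) {g : ι → ι → ℝ} (hg : IsFlow u p g) :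
    ∑ i, surplus p f i ^ 2 ≤ ∑ i, surplus p g i ^ 2 :=
  (Real.sqrt_le_sqrt_iff (Finset.sum_nonneg fun _ _ => sq_nonneg _)).1 (h.2 g hg)

/-- First-order optimality of a balanced flow under a change of the flow into a single good. -/
theorem IsBalanced.perturb (hf : IsBalanced u p f) (q : ι) (d : ι → ℝ)
    (hsupp : ∀ i, d i ≠ 0 → EqualityEdge u p i q) (hn : ∀ i, 0 ≤ f i q + d i)
    (hb : ∀ i, d i ≤ surplus p f i) (hs : ∑ i, f i q + ∑ i, d i ≤ p q) :
    ∑ i, 2 * (d i * surplus p f i) ≤ ∑ i, d i ^ 2 := by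
  classical
  let g : ι → ι → ℝ := fun i j => f i j + if j = q then d i else 0
  have hsum : ∀ i, ∑ j, g i j = ∑ j, f i j + d i := fun i => by
    simp [g, Finset.sum_add_distrib]
  have hsur : ∀ i, surplus p g i = surplus p f i - d i := fun i => by
    rw [surplus, hsum, surplus]; ring
  have hg : IsFlow u p g := by
    refine ⟨fun i j => ?_, fun i j hij => ?_, fun i => ?_, fun j => ?_⟩
    · by_cases hj : j = q
      · subst hj; simpa [g] using hn i
      · simpa [g, hj] using hf.1.nonneg i j
    · by_cases hj : j = q
      · subst hj
        have : d i = 0 := by_contra fun h => hij (hsupp i h)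
        simp [g, this, hf.1.support i j hij]
      · simp [g, hj, hf.1.support i j hij]
    · have := hb i
      rw [surplus] at this
      rw [hsum]; linarith
    · by_cases hj : j = q
      · subst hj
        simpa [g, Finset.sum_add_distrib] using hs
      · simpa [g, hj] using hf.1.supply j
  have key := hf.sum_sq_le hg
  simp only [hsur] at key
  have : ∑ i, (surplus p f i - d i) ^ 2 =
      ∑ i, surplus p f i ^ 2 - ∑ i, 2 * (d i * surplus p f i) + ∑ i, d i ^ 2 := by
    rw [← Finset.sum_sub_distrib, ← Finset.sum_add_distrib]
    exact Finset.sum_congr rfl fun i _ => by ring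
  linarith

/-- Otherwise moving a little of the purchase of `q` from `b` to `a` would bring the two surpluses
closer and lower the norm. -/
theorem IsBalanced.surplus_le_of_flow_pos (hf : IsBalanced u p f) {a b q : ι}
    (ha : EqualityEdge u p a q) (hb : 0 < f b q) : surplus p f a ≤ surplus p f b := by
  classical
  by_contra! hlt
  have hab : a ≠ b := by rintro rfl; exact lt_irrefl _ hlt
  have hedge : EqualityEdge u p b q := by_contra fun h => hb.ne' (hf.1.support b q h)
  -- Half the difference keeps the quadratic term `2 δ²` below the linear gain; it also respects the
  -- budget of `a`, as the surplus of `b` is nonnegative.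
  set δ := min (f b q) ((surplus p f a - surplus p f b) / 2) with hδ
  have hδ0 : 0 < δ := lt_min hb (by linarith)
  have hδ1 : δ ≤ f b q := min_le_left _ _
  have hδ2 : δ ≤ (surplus p f a - surplus p f b) / 2 := min_le_right _ _
  have hrb := hf.1.surplus_nonneg b
  let d : ι → ℝ := fun i => (if i = a then δ else 0) - if i = b then δ else 0
  have hda : d a = δ := by simp [d, hab]
  have hdb : d b = -δ := by simp [d, hab.symm]
  have hd0 : ∀ i, i ≠ a → i ≠ b → d i = 0 := fun i h1 h2 => by simp [d, h1, h2]
  have hsum : ∀ w : ι → ℝ, ∑ i, d i * w i = δ * w a - δ * w b := fun w => by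
    simp [d, sub_mul, Finset.sum_sub_distrib]
  have h := hf.perturb q d ?_ ?_ ?_ ?_
  · have h1 : ∑ i, 2 * (d i * surplus p f i) = 2 * (δ * surplus p f a - δ * surplus p f b) := by
      rw [← Finset.mul_sum, hsum]
    have h2 : ∑ i, d i ^ 2 = 2 * δ ^ 2 := by
      simp only [sq]
      rw [hsum, hda, hdb]; ring
    rw [h1, h2] at h
    nlinarith
  · intro i hi
    by_cases h1 : i = a
    · rwa [h1]
    by_cases h2 : i = b
    · rwa [h2]
    exact absurd (hd0 i h1 h2) hi
  · intro i
    by_cases h1 : i = a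
    · rw [h1, hda]; have := hf.1.nonneg a q; linarith
    by_cases h2 : i = b
    · rw [h2, hdb]; linarith
    rw [hd0 i h1 h2]; simpa using hf.1.nonneg i q
  · intro i
    by_cases h1 : i = a
    · rw [h1, hda]; linarith
    by_cases h2 : i = b
    · rw [h2, hdb]; linarith
    rw [hd0 i h1 h2]; exact hf.1.surplus_nonneg i
  · have : ∑ i, d i = 0 := by simpa using hsum 1
    rw [this, add_zero]
    exact hf.1.supply q

theorem IsBalanced.sold_of_surplus_pos (hf : IsBalanced u p f) {a q : ι}
    (ha : EqualityEdge u p a q) (hr : 0 < surplus p f a) : ∑ i, f i q = p q := by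
  classical
  refine (hf.1.supply q).antisymm ?_
  by_contra! hlt
  set δ := min (p q - ∑ i, f i q) (surplus p f a)
  have hδ0 : 0 < δ := lt_min (by linarith) hr
  have hδ1 : δ ≤ p q - ∑ i, f i q := min_le_left _ _
  have hδ2 : δ ≤ surplus p f a := min_le_right _ _
  let d : ι → ℝ := fun i => if i = a then δ else 0
  have h := hf.perturb q d ?_ ?_ ?_ ?_
  · have h1 : ∑ i, 2 * (d i * surplus p f i) = 2 * (δ * surplus p f a) := by
      simp [d]
    have h2 : ∑ i, d i ^ 2 = δ ^ 2 := by simp [d]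
    rw [h1, h2] at h
    nlinarith
  · intro i hi
    by_cases h1 : i = a
    · rwa [h1]
    · simp [d, h1] at hi
  · intro i
    have := hf.1.nonneg i q
    simp only [d]
    split_ifs <;> linarith
  · intro i
    simp only [d]
    split_ifs with h1
    · rwa [h1]
    · exact hf.1.surplus_nonneg i
  · simp only [d, Finset.sum_ite_eq', Finset.mem_univ, if_true]
    linarith

theorem IsFlow.sum_pos (h : IsFlow u p f) {i : ι} (hi : surplus p f i < p i) :
    ∃ j, 0 < f i j ∧ EqualityEdge u p i j := by
  have : 0 < ∑ j, f i j := by rw [surplus] at hi; linarith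
  obtain ⟨j, -, hj⟩ := Finset.exists_lt_of_sum_lt (s := Finset.univ) (f := fun _ : ι => (0 : ℝ))
    (g := f i) (by simpa using this)
  exact ⟨j, hj, by_contra fun hn => hj.ne' (h.support i j hn)⟩

theorem IsFlow.surplus_le (h : IsFlow u p f) (i : ι) : surplus p f i ≤ p i := by
  have : 0 ≤ ∑ j, f i j := Finset.sum_nonneg fun j _ => h.nonneg i j
  rw [surplus]; linarith

theorem IsBalanced.surplus_le_of_edge (hf : IsBalanced u p f) {a b : ι} (hp : p a ≤ p b)
    (he : ∀ j, EqualityEdge u p b j → EqualityEdge u p a j) :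
    surplus p f a ≤ surplus p f b := by
  by_contra! hlt
  obtain ⟨j, hj, hbj⟩ := hf.1.sum_pos (hlt.trans_le ((hf.1.surplus_le a).trans hp))
  exact hlt.not_ge (hf.surplus_le_of_flow_pos (he j hbj) hj)

/-- Goods that are sold out cost no more than the total budget of the agents interested in them. -/
theorem IsFlow.sum_price_le (hf : IsFlow u p f) (Q A : Finset ι)
    (hQ : ∀ q ∈ Q, ∑ i, f i q = p q) (hA : ∀ q ∈ Q, ∀ i, EqualityEdge u p i q → i ∈ A) :
    ∑ q ∈ Q, p q ≤ ∑ i ∈ A, p i := by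
  calc ∑ q ∈ Q, p q = ∑ q ∈ Q, ∑ i ∈ A, f i q := by
        refine Finset.sum_congr rfl fun q hq => ?_
        rw [← hQ q hq]
        refine (Finset.sum_subset (Finset.subset_univ A) fun i _ hi => ?_).symm
        exact hf.support i q fun h => hi (hA q hq i h)
    _ = ∑ i ∈ A, ∑ q ∈ Q, f i q := Finset.sum_comm
    _ ≤ ∑ i ∈ A, p i := Finset.sum_le_sum fun i _ =>
        (Finset.sum_le_sum_of_subset_of_nonneg (Finset.subset_univ Q)
          fun j _ _ => hf.nonneg i j).trans (hf.budget i)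

theorem IsBalanced.flow_eq_zero_of_notMem (hf : IsBalanced u p f) {S : Set ι}
    (hS : ∀ i ∈ S, ∀ j, surplus p f i ≤ surplus p f j → j ∈ S) {i q : ι} (hi : i ∉ S)
    (hq : q ∈ neighbors u p S) : f i q = 0 := by
  obtain ⟨a, ha, haq⟩ := hq
  by_contra h
  exact hi (hS a ha i (hf.surplus_le_of_flow_pos haq ((hf.1.nonneg i q).lt_of_ne' h)))

/-- If some valid flow sells out all goods that are of no interest to agents with positive surplus,
then no agent has positive surplus. -/
theorem IsBalanced.surplus_eq_zero (hf : IsBalanced u p f) {g : ι → ι → ℝ} (hg : IsFlow u p g)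
    (h : ∀ q, q ∉ neighbors u p {i | 0 < surplus p f i} → ∑ i, g i q = p q) (a : ι) :
    surplus p f a = 0 := by
  classical
  -- A cut argument. Under `g`, goods outside `G` are paid for by agents outside `S`; under `f`,
  -- goods in `G` are paid for by `S` alone, which keeps its surplus. Since total prices equal total
  -- budgets, that surplus is zero.
  set S : Set ι := {i | 0 < surplus p f i} with hS
  set G := neighbors u p S with hG
  have h1 : ∑ q with q ∉ G, p q ≤ ∑ i with i ∉ S, p i := by
    refine hg.sum_price_le _ _ (fun q hq => h q (Finset.mem_filter.1 hq).2) fun q hq i hi => ?_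
    simp only [Finset.mem_filter, Finset.mem_univ, true_and] at hq ⊢
    exact fun hiS => hq ⟨i, hiS, hi⟩
  have h2 : ∑ q with q ∈ G, p q ≤ ∑ i with i ∈ S, (p i - surplus p f i) := by
    calc ∑ q with q ∈ G, p q = ∑ q with q ∈ G, ∑ i with i ∈ S, f i q := by
          refine Finset.sum_congr rfl fun q hq => ?_
          obtain ⟨b, hb, hbq⟩ := (Finset.mem_filter.1 hq).2
          rw [← hf.sold_of_surplus_pos hbq hb]
          refine (Finset.sum_subset (Finset.subset_univ _) fun i _ hi => ?_).symm
          exact hf.flow_eq_zero_of_notMem (fun i hi j hij => lt_of_lt_of_le hi hij)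
            (fun h => hi (Finset.mem_filter.2 ⟨Finset.mem_univ _, h⟩))
            (Finset.mem_filter.1 hq).2
      _ = ∑ i with i ∈ S, ∑ q with q ∈ G, f i q := Finset.sum_comm
      _ ≤ ∑ i with i ∈ S, (p i - surplus p f i) := Finset.sum_le_sum fun i _ => by
          rw [surplus, sub_sub_cancel]
          exact Finset.sum_le_sum_of_subset_of_nonneg (Finset.subset_univ _)
            fun j _ _ => hf.1.nonneg i j
  have h3 := Finset.sum_filter_add_sum_filter_not Finset.univ (· ∈ G) p
  have h4 := Finset.sum_filter_add_sum_filter_not Finset.univ (· ∈ S) p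
  rw [Finset.sum_sub_distrib] at h2
  have h5 : ∑ i with i ∈ S, surplus p f i ≤ 0 := by linarith
  by_contra ha
  have haS : 0 < surplus p f a := (hf.1.surplus_nonneg a).lt_of_ne' ha
  refine h5.not_gt (Finset.sum_pos' (fun i _ => hf.1.surplus_nonneg i) ⟨a, ?_, haS⟩)
  exact Finset.mem_filter.2 ⟨Finset.mem_univ _, haS⟩

/-! The set of the agents of high surplus. -/

theorem mem_highSurplus_of_le {r : ι → ℝ} {i j : ι} (hi : i ∈ highSurplus r) (hij : r i ≤ r j) :
    j ∈ highSurplus r := fun k hk => (hi k hk).trans hij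

/-- An agent of least positive surplus is a gap agent, because everything below it is zero. -/
theorem pos_of_mem_highSurplus {r : ι → ℝ} (hr : ∀ i, 0 ≤ r i) (hpos : ∃ i, 0 < r i) {k : ι}
    (hk : k ∈ highSurplus r) : 0 < r k := by
  classical
  obtain ⟨i, hi⟩ := hpos
  obtain ⟨m, hm, hmin⟩ := Finset.exists_min_image (Finset.univ.filter fun i => 0 < r i) r
    ⟨i, by simpa using hi⟩
  simp only [Finset.mem_filter, Finset.mem_univ, true_and] at hm hmin
  refine hm.trans_le (hk m fun j hj => ?_)
  have : r j = 0 := by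
    by_contra h
    exact (hmin j ((hr j).lt_of_ne' h)).not_gt hj
  simpa [this] using hm

/-- With nothing strictly between, `i` would be a gap agent and would cut `k` off from the
high-surplus set. -/
theorem exists_between_of_mem_highSurplus {r : ι → ℝ} {i k : ι} (hk : k ∈ highSurplus r)
    (hki : r k < r i) (hgap : (1 + 1 / (Fintype.card ι : ℝ)) * r k < r i) :
    ∃ j, r k < r j ∧ r j < r i := by
  by_contra! h
  refine hki.not_ge (hk i fun j hj => ?_)
  have hjk : r j ≤ r k := by
    by_contra! hlt
    exact (h j hlt).not_gt hj
  refine lt_of_le_of_lt ?_ hgap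
  have : (0 : ℝ) ≤ 1 + 1 / (Fintype.card ι : ℝ) := by positivity
  exact mul_le_mul_of_nonneg_left hjk this

theorem exists_surplus_pos (hf : IsFlow u p f) (h : 0 < surplusNorm p f) :
    ∃ i, 0 < surplus p f i := by
  by_contra! hn
  have h0 : ∀ i, surplus p f i = 0 := fun i => (hn i).antisymm (hf.surplus_nonneg i)
  simp [surplusNorm, h0] at h

theorem surplus_le_surplusNorm (i : ι) : surplus p f i ≤ surplusNorm p f :=
  Real.le_sqrt_of_sq_le (Finset.single_le_sum (f := fun i => surplus p f i ^ 2)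
    (fun _ _ => sq_nonneg _) (Finset.mem_univ i))

theorem threshold_nonneg (u : ι → ι → ℕ) : 0 ≤ threshold u := by
  unfold threshold; positivity

/-! The price update. -/

theorem one_le_of_mem_factors (hp : ∀ j, 0 < p j) {S G : Set ι} {x : ℝ}
    (hx : x ∈ {xMax ι} ∪ edgeFactors u p S G
      ∪ meetFactors p f G (S \ G) (G \ S)
      ∪ meetFactors p f G (S \ G) (S ∪ G)ᶜ
      ∪ meetFactors p f G (S ∩ G) (G \ S)
      ∪ zeroFactors p f G (S \ G)) : 1 ≤ x := by
  rcases hx with ((((rfl | h) | h) | h) | h) | h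
  · unfold xMax
    have : (0 : ℝ) ≤ 1 / (8 * Real.exp 1 ^ 2 * (Fintype.card ι : ℝ) ^ 3) := by positivity
    linarith
  · obtain ⟨i, hi, j, hij, k, hk, huk, rfl⟩ := h
    have hu : (0 : ℝ) < u i k := by exact_mod_cast huk
    have h1 := hij k
    have h2 : (1 : ℝ) = (u i k / p k) * (p k / u i k) := by
      have := (hp k).ne'
      field_simp
    rw [h2]
    exact mul_le_mul_of_nonneg_right h1 (div_nonneg (hp k).le hu.le)
  all_goals exact h.1.le

variable (u p f) in
theorem updateFactor_bddBelow (hp : ∀ j, 0 < p j) {S G : Set ι} :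
    BddBelow ({xMax ι} ∪ edgeFactors u p S G
      ∪ meetFactors p f G (S \ G) (G \ S)
      ∪ meetFactors p f G (S \ G) (S ∪ G)ᶜ
      ∪ meetFactors p f G (S ∩ G) (G \ S)
      ∪ zeroFactors p f G (S \ G)) :=
  ⟨1, fun _ hx => one_le_of_mem_factors hp hx⟩

theorem one_le_updateFactor (hp : ∀ j, 0 < p j) {S G : Set ι} :
    1 ≤ updateFactor u p f S G :=
  le_csInf ⟨xMax ι, by simp⟩ fun _ hx => one_le_of_mem_factors hp hx

theorem updateFactor_le_xMax (hp : ∀ j, 0 < p j) {S G : Set ι} :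
    updateFactor u p f S G ≤ xMax ι :=
  csInf_le (updateFactor_bddBelow u p f hp) (by simp)

theorem updateFactor_le_edge (hp : ∀ j, 0 < p j) {S G : Set ι} {i j k : ι}
    (hi : i ∈ S) (hij : EqualityEdge u p i j) (hk : k ∉ G) (hu : 0 < u i k) :
    updateFactor u p f S G ≤ ((u i j : ℝ) / p j) * (p k / (u i k : ℝ)) :=
  csInf_le (updateFactor_bddBelow u p f hp)
    (Or.inl (Or.inl (Or.inl (Or.inl (Or.inr ⟨i, hi, j, hij, k, hk, hu, rfl⟩)))))

/-- The role of `x_2`: a type-2 agent, whose budget stays fixed, can still afford its scaled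
purchases. -/
theorem updateFactor_mul_sum_le (hf : IsFlow u p f) (hp : ∀ j, 0 < p j) {S G : Set ι}
    (hG : neighbors u p S ⊆ G) {i : ι} (hi : i ∈ S) (hiG : i ∉ G) (hr : 0 < surplus p f i) :
    updateFactor u p f S G * ∑ j, f i j ≤ p i := by
  have hs : ∑ j, f i j < p i := by rw [surplus] at hr; linarith
  by_contra! hlt
  have hs0 : 0 < ∑ j, f i j := by
    refine (Finset.sum_nonneg fun j _ => hf.nonneg i j).lt_of_ne' fun h => ?_
    rw [h, mul_zero] at hlt
    exact (hp i).not_gt hlt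
  have hle : updateFactor u p f S G ≤ p i / ∑ j, f i j := by
    refine csInf_le (updateFactor_bddBelow u p f hp)
      (Or.inr ⟨(one_lt_div hs0).2 hs, i, ⟨hi, hiG⟩, ?_⟩)
    have hsc : ∀ j, scaleFlow G (p i / ∑ j, f i j) f i j = (p i / ∑ j, f i j) * f i j := by
      intro j
      unfold scaleFlow
      split_ifs with hj
      · rfl
      · have : f i j = 0 := hf.support i j fun he => hj (hG ⟨i, hi, he⟩)
        rw [this, mul_zero]
    simp only [newSurplus, surplus, hsc, scalePrice, if_neg hiG, ← Finset.mul_sum]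
    rw [div_mul_cancel₀ _ hs0.ne', sub_self]
  rw [le_div_iff₀ hs0] at hle
  exact hle.not_gt hlt

theorem le_scalePrice {κ : Type*} {p : κ → ℝ} (hp : ∀ j, 0 < p j) {G : Set κ} {x : ℝ}
    (hx : 1 ≤ x) (j : κ) : p j ≤ scalePrice G x p j := by
  unfold scalePrice
  split_ifs
  · exact le_mul_of_one_le_left (hp j).le hx
  · exact le_rfl

/-- Goods that some valid flow sells out before an iteration can be sold out after it. -/
theorem IsBalanced.exists_flow_updatePrice (hf : IsBalanced u p f) (hp : ∀ j, 0 < p j)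
    (hr : 0 < surplusNorm p f) {g : ι → ι → ℝ} (hg : IsFlow u p g) :
    ∃ g', IsFlow u (updatePrice u p f) g' ∧
      ∀ j, ∑ i, g i j = p j → ∑ i, g' i j = updatePrice u p f j := by
  classical
  set S := highSurplus (surplus p f) with hS
  set G := neighbors u p S with hG
  set x := updateFactor u p f S G with hx
  have hup : updatePrice u p f = scalePrice G x p := rfl
  have hSpos : ∀ i ∈ S, 0 < surplus p f i := fun i hi =>
    pos_of_mem_highSurplus hf.1.surplus_nonneg (exists_surplus_pos hf.1 hr) hi
  have hSup : ∀ i ∈ S, ∀ j, surplus p f i ≤ surplus p f j → j ∈ S := fun i hi j hij =>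
    mem_highSurplus_of_le hi hij
  have hx1 : 1 ≤ x := one_le_updateFactor hp
  have hx0 : 0 < x := zero_lt_one.trans_le hx1
  have hfS : ∀ i ∈ S, ∀ j, j ∉ G → f i j = 0 := fun i hi j hj =>
    hf.1.support i j fun he => hj ⟨i, hi, he⟩
  have hgS : ∀ i ∈ S, ∀ j, j ∉ G → g i j = 0 := fun i hi j hj =>
    hg.support i j fun he => hj ⟨i, hi, he⟩
  -- Agents of `S` follow the scaled balanced flow, which already sells out `G`; all others keep `g`
  -- outside `G`. The edges used survive: those of `S` because `x ≤ x_eq`, the others because their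
  -- own price is unchanged while competing prices do not fall.
  let g' : ι → ι → ℝ := fun i j => if i ∈ S then x * f i j else if j ∈ G then 0 else g i j
  have hGsold : ∀ j ∈ G, ∑ i, g' i j = x * p j := by
    intro j hj
    obtain ⟨a, ha, haj⟩ := id hj
    rw [← hf.sold_of_surplus_pos haj (hSpos a ha), Finset.mul_sum]
    refine Finset.sum_congr rfl fun i _ => ?_
    by_cases hi : i ∈ S
    · simp [g', hi]
    · simp [g', hi, hj, hf.flow_eq_zero_of_notMem hSup hi hj]
  have hGc : ∀ j ∉ G, ∑ i, g' i j = ∑ i, g i j := by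
    intro j hj
    refine Finset.sum_congr rfl fun i _ => ?_
    by_cases hi : i ∈ S
    · simp [g', hi, hfS i hi j hj, hgS i hi j hj]
    · simp [g', hi, hj]
  refine ⟨g', ⟨fun i j => ?_, fun i j hij => ?_, fun i => ?_, fun j => ?_⟩, fun j hj => ?_⟩
  · simp only [g']
    split_ifs
    · exact mul_nonneg hx0.le (hf.1.nonneg i j)
    · exact le_rfl
    · exact hg.nonneg i j
  · simp only [g']
    split_ifs with hi hj
    · by_contra hne
      have hfij : f i j ≠ 0 := fun h => hne (by rw [h, mul_zero])
      have he : EqualityEdge u p i j := by_contra fun h => hfij (hf.1.support i j h)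
      have hjG : j ∈ G := ⟨i, hi, he⟩
      refine hij fun k => ?_
      rw [hup]
      by_cases hk : k ∈ G
      · simp only [scalePrice, hk, hjG, if_true]
        rw [mul_comm x, mul_comm x, ← div_div, ← div_div]
        exact div_le_div_of_nonneg_right (he k) hx0.le
      · simp only [scalePrice, hk, hjG, if_true, if_false]
        rcases Nat.eq_zero_or_pos (u i k) with h0 | h0
        · rw [h0]
          have := hp j
          simp only [Nat.cast_zero, zero_div]
          positivity
        · have hle := updateFactor_le_edge (f := f) hp hi he hk h0
          rw [← hx] at hle
          have hu : (0 : ℝ) < u i k := by exact_mod_cast h0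
          have h1 := hp k
          have h2 := hp j
          rw [div_le_div_iff₀ h1 (by positivity)]
          rw [div_mul_div_comm, le_div_iff₀ (by positivity)] at hle
          linarith
    · rfl
    · refine hg.support i j fun he => hij fun k => ?_
      rw [hup]
      have h1 : scalePrice G x p j = p j := by simp [scalePrice, hj]
      rw [h1]
      exact (div_le_div_of_nonneg_left (Nat.cast_nonneg _) (hp k) (le_scalePrice hp hx1 k)).trans
        (he k)
  · by_cases hi : i ∈ S
    · simp only [g', hi, if_true, ← Finset.mul_sum]
      by_cases hiG : i ∈ G
      · simp only [hup, scalePrice, hiG, if_true]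
        exact mul_le_mul_of_nonneg_left (hf.1.budget i) hx0.le
      · simp only [hup, scalePrice, hiG, if_false]
        exact updateFactor_mul_sum_le hf.1 hp subset_rfl hi hiG (hSpos i hi)
    · refine le_trans ?_ ((hg.budget i).trans (le_scalePrice hp hx1 i))
      refine Finset.sum_le_sum fun j _ => ?_
      simp only [g', hi, if_false]
      split_ifs
      · exact hg.nonneg i j
      · exact le_rfl
  · by_cases hjG : j ∈ G
    · rw [hGsold j hjG, hup]; simp [scalePrice, hjG]
    · rw [hGc j hjG, hup]; simpa [scalePrice, hjG] using hg.supply j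
  · by_cases hjG : j ∈ G
    · rw [hGsold j hjG, hup]; simp [scalePrice, hjG]
    · rw [hGc j hjG, hup, hj]; simp [scalePrice, hjG]

end General

/-! ### Arithmetic of the ratios and the ordering of the blocks -/

section Positions

variable {n : ℕ}

theorem mem_blocks_iff {b : ℕ × ℕ} : b ∈ blocks n ↔
    (b.1 < n ∧ b.2 < n) ∧ b.1.Prime ∧ (b.1 : ℝ) < (n : ℝ) ^ (1 / 3 : ℝ) ∧ 1 ≤ b.2 ∧ b.2 < b.1 := by
  simp [blocks]

/-- This is why the sizes are prime: `j / i` with `1 ≤ j < i` is then in lowest terms. -/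
theorem ratio_injOn {b c : ℕ × ℕ} (hb : b ∈ blocks n) (hc : c ∈ blocks n)
    (h : ratio b = ratio c) : b = c := by
  obtain ⟨-, hbp, -, hb1, hb2⟩ := mem_blocks_iff.1 hb
  obtain ⟨-, hcp, -, hc1, hc2⟩ := mem_blocks_iff.1 hc
  have hb0 : (b.1 : ℚ) ≠ 0 := by exact_mod_cast hbp.ne_zero
  have hc0 : (c.1 : ℚ) ≠ 0 := by exact_mod_cast hcp.ne_zero
  unfold ratio at h
  rw [div_eq_div_iff hb0 hc0] at h
  have h1 : b.2 * c.1 = c.2 * b.1 := by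
    have : (b.2 : ℚ) * c.1 = c.2 * b.1 := by linarith
    exact_mod_cast this
  have h2 : b.1 ∣ c.1 := by
    have : b.1 ∣ b.2 * c.1 := ⟨c.2, by rw [h1, mul_comm]⟩
    exact (hbp.dvd_mul.1 this).resolve_left fun hd => (Nat.le_of_dvd hb1 hd).not_gt hb2
  have h3 : b.1 = c.1 := (Nat.prime_dvd_prime_iff_eq hbp hcp).1 h2
  refine Prod.ext h3 ?_
  rw [← h3] at h1
  exact Nat.eq_of_mul_eq_mul_right hbp.pos h1

theorem position_le_position {b c : ℕ × ℕ} (h : ratio c ≤ ratio b) :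
    position n b ≤ position n c :=
  Finset.card_le_card fun a ha => by
    rw [Finset.mem_filter] at ha ⊢
    exact ⟨ha.1, h.trans_lt ha.2⟩

theorem position_lt_position {b c : ℕ × ℕ} (hb : b ∈ blocks n) (h : ratio c < ratio b) :
    position n b < position n c := by
  refine Finset.card_lt_card (Finset.ssubset_iff_of_subset (fun a ha => ?_) |>.2 ⟨b, ?_, ?_⟩)
  · rw [Finset.mem_filter] at ha ⊢
    exact ⟨ha.1, h.trans ha.2⟩
  · exact Finset.mem_filter.2 ⟨hb, h⟩
  · simp

theorem ratio_lt_of_position_lt {b c : ℕ × ℕ} (h : position n b < position n c) :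
    ratio c < ratio b :=
  lt_of_not_ge fun hle => (position_le_position hle).not_gt h

theorem position_injOn {b c : ℕ × ℕ} (hb : b ∈ blocks n) (hc : c ∈ blocks n)
    (h : position n b = position n c) : b = c := by
  refine ratio_injOn hb hc ?_
  rcases lt_trichotomy (ratio b) (ratio c) with h1 | h1 | h1
  · exact absurd h (position_lt_position hc h1).ne'
  · exact h1
  · exact absurd h (position_lt_position hb h1).ne

theorem position_lt_card {b : ℕ × ℕ} (hb : b ∈ blocks n) : position n b < (blocks n).card :=
  Finset.card_lt_card (Finset.ssubset_iff_of_subset (Finset.filter_subset _ _) |>.2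
    ⟨b, hb, by simp⟩)

theorem exists_position_eq {k : ℕ} (hk : k < (blocks n).card) : ∃ b ∈ blocks n, position n b = k := by
  have : (blocks n).image (position n) = Finset.range (blocks n).card := by
    refine Finset.eq_of_subset_of_card_le ?_ ?_
    · intro k hk
      obtain ⟨b, hb, rfl⟩ := Finset.mem_image.1 hk
      exact Finset.mem_range.2 (position_lt_card hb)
    · rw [Finset.card_image_of_injOn fun b hb c hc h => position_injOn hb hc h, Finset.card_range]
  have hk' : k ∈ (blocks n).image (position n) := this ▸ Finset.mem_range.2 hk
  simpa using hk'

theorem one_le_card_agent (hn : 1 ≤ n) : 1 ≤ Fintype.card (Agent n) := by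
  rw [Fintype.card_sum, Fintype.card_fin]; omega

theorem le_card_agent (n : ℕ) : n ≤ Fintype.card (Agent n) := by
  rw [Fintype.card_sum, Fintype.card_fin]; omega

/-- The relative gap between the ratios of two blocks. -/
theorem ratio_gap {b c : ℕ × ℕ} (hb : b ∈ blocks n) (hc : c ∈ blocks n) (h : ratio c < ratio b) :
    (1 + 1 / (Fintype.card (Agent n) : ℝ)) * (ratio c : ℝ) < ratio b := by
  obtain ⟨⟨hbn, -⟩, hbp, hb3, hb1, hb2⟩ := mem_blocks_iff.1 hb
  obtain ⟨⟨hcn, -⟩, hcp, hc3, hc1, hc2⟩ := mem_blocks_iff.1 hc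
  have hn1 : (1 : ℝ) ≤ n := by exact_mod_cast (by omega : 1 ≤ n)
  have hb0 : (0 : ℝ) < b.1 := by exact_mod_cast hbp.pos
  have hc0 : (0 : ℝ) < c.1 := by exact_mod_cast hcp.pos
  -- Distinct fractions differ by at least the reciprocal of the product of their denominators. Both
  -- sizes are below `n^(1/3)`, so this difference exceeds `1 / N`; since ratios are below `1`, it
  -- is also a relative gap.
  have hN : (b.1 : ℝ) * c.1 < Fintype.card (Agent n) := by
    have h1 : (b.1 : ℝ) * c.1 < (n : ℝ) ^ (1 / 3 : ℝ) * (n : ℝ) ^ (1 / 3 : ℝ) :=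
      mul_lt_mul hb3 hc3.le hc0 (by positivity)
    have h2 : (n : ℝ) ^ (1 / 3 : ℝ) * (n : ℝ) ^ (1 / 3 : ℝ) ≤ n := by
      rw [← Real.rpow_add (by linarith)]
      exact (Real.rpow_le_rpow_of_exponent_le hn1 (by norm_num)).trans_eq (Real.rpow_one _)
    have h3 : (n : ℝ) ≤ Fintype.card (Agent n) := by exact_mod_cast le_card_agent n
    linarith
  have hrc : (ratio c : ℝ) = ((c.1 : ℝ) - c.2) / c.1 := by simp [ratio]
  have hrb : (ratio b : ℝ) = ((b.1 : ℝ) - b.2) / b.1 := by simp [ratio]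
  have hlt : (ratio c : ℝ) < ratio b := by exact_mod_cast h
  have hr1 : (ratio c : ℝ) < 1 := by
    rw [hrc, div_lt_one hc0]
    have : (1 : ℝ) ≤ c.2 := by exact_mod_cast hc1
    linarith
  have hgap : 1 / ((b.1 : ℝ) * c.1) ≤ ratio b - ratio c := by
    rw [hrb, hrc, div_lt_div_iff₀ hc0 hb0] at hlt
    rw [hrb, hrc, div_sub_div _ _ hb0.ne' hc0.ne']
    refine div_le_div_of_nonneg_right ?_ (by positivity)
    have h1 : ((c.1 - c.2 : ℤ) * b.1 : ℤ) < (b.1 - b.2 : ℤ) * c.1 := by exact_mod_cast hlt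
    have h2 : ((c.1 - c.2 : ℤ) * b.1 : ℤ) + 1 ≤ (b.1 - b.2 : ℤ) * c.1 := h1
    have h3 : ((c.1 - c.2 : ℝ) * b.1 : ℝ) + 1 ≤ (b.1 - b.2 : ℝ) * c.1 := by exact_mod_cast h2
    linarith
  have hinv : 1 / (Fintype.card (Agent n) : ℝ) < 1 / ((b.1 : ℝ) * c.1) :=
    one_div_lt_one_div_of_lt (by positivity) hN
  have : 1 / (Fintype.card (Agent n) : ℝ) * ratio c ≤ 1 / (Fintype.card (Agent n) : ℝ) :=
    mul_le_of_le_one_right (by positivity) hr1.le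
  linarith

/-- An agent of one of the blocks other than the last one. -/
abbrev BlockAgent (n : ℕ) : Type := Σ b : {b : ℕ × ℕ // b ∈ blocks n}, Fin b.1.1

theorem exists_high (b : {b : ℕ × ℕ // b ∈ blocks n}) : ∃ a : BlockAgent n, a.1 = b ∧ IsHigh a := by
  obtain ⟨-, hbp, -, hb1, hb2⟩ := mem_blocks_iff.1 b.2
  exact ⟨⟨b, ⟨0, hbp.pos⟩⟩, rfl, hb1⟩

theorem exists_low (b : {b : ℕ × ℕ // b ∈ blocks n}) : ∃ a : BlockAgent n, a.1 = b ∧ ¬ IsHigh a := by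
  obtain ⟨-, hbp, -, hb1, hb2⟩ := mem_blocks_iff.1 b.2
  exact ⟨⟨b, ⟨b.1.2, hb2⟩⟩, rfl, lt_irrefl _⟩

theorem fst_eq_of_position_eq {a b : BlockAgent n} (h : position n a.1 = position n b.1) :
    a.1 = b.1 :=
  Subtype.ext (position_injOn a.1.2 b.1.2 h)

end Positions

/-! ### Equality network and balanced surpluses at block prices -/

section Edges

variable {n U : ℕ} {P : ℕ → ℝ}

open Classical in
/-- The prices at which the high-demand goods of the block at position `k` cost `P k` and all other
goods cost `1`. -/
noncomputable def blockPrice (n : ℕ) (P : ℕ → ℝ) : Agent n → ℝ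
  | .inl a => if IsHigh a then P (position n a.1) else 1
  | .inr _ => 1

/-- The price of the goods that compete with the high-demand goods of the block at position `k`. -/
def prevPrice (P : ℕ → ℝ) : ℕ → ℝ
  | 0 => 1
  | k + 1 => P k

theorem blockPrice_high {a : BlockAgent n} (h : IsHigh a) :
    blockPrice n P (.inl a) = P (position n a.1) := if_pos h

theorem blockPrice_low {a : BlockAgent n} (h : ¬ IsHigh a) : blockPrice n P (.inl a) = 1 := if_neg h

theorem one_le_blockPrice (hP : ∀ k, 1 ≤ P k) (i : Agent n) : 1 ≤ blockPrice n P i := by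
  rcases i with a | k
  · by_cases h : IsHigh a
    · rw [blockPrice_high h]; exact hP _
    · rw [blockPrice_low h]
  · exact le_rfl

theorem blockPrice_pos (hP : ∀ k, 1 ≤ P k) (i : Agent n) : 0 < blockPrice n P i :=
  zero_lt_one.trans_le (one_le_blockPrice hP i)

theorem utility_own {a b : BlockAgent n} (h : a.1 = b.1) (hb : IsHigh b) :
    utility n U (.inl a) (.inl b) = 2 * U := by
  simp [utility, h, hb]

theorem utility_first {a b : BlockAgent n} (h0 : position n a.1 = 0) (ha : IsHigh a)
    (hb : ¬ IsHigh b) : utility n U (.inl a) (.inl b) = 2 := by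
  simp [utility, h0, ha, hb]

theorem utility_next {a b : BlockAgent n} (h : position n a.1 = position n b.1 + 1) (ha : IsHigh a)
    (hb : IsHigh b) : utility n U (.inl a) (.inl b) = 2 := by
  have : a.1 ≠ b.1 := fun h' => by rw [h'] at h; omega
  simp [utility, h, ha, hb, this]

theorem utility_congr_left {a a' : BlockAgent n} (h : a.1 = a'.1) (hh : IsHigh a ↔ IsHigh a') :
    utility n U (.inl a) = utility n U (.inl a') := by
  funext g
  rcases g with g | g <;> simp only [utility] <;> rw [h, propext hh]

theorem utility_congr_right (a : BlockAgent n) {b b' : BlockAgent n} (h : b.1 = b'.1)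
    (hh : IsHigh b ↔ IsHigh b') : utility n U (.inl a) (.inl b) = utility n U (.inl a) (.inl b') := by
  simp only [utility]
  rw [h, propext hh]

theorem EqualityEdge.congr {ι : Type*} {u : ι → ι → ℕ} {p : ι → ℝ} {i j j' : ι}
    (h : EqualityEdge u p i j) (hu : u i j = u i j') (hp : p j = p j') : EqualityEdge u p i j' := by
  intro k
  rw [← hu, ← hp]
  exact h k

theorem exists_equalityEdge {ι : Type*} [Finite ι] [Nonempty ι] (u : ι → ι → ℕ) (p : ι → ℝ) (i : ι) :
    ∃ j, EqualityEdge u p i j :=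
  Finite.exists_max fun j => (u i j : ℝ) / p j

/-- The own good offers `U ≥ 2` per unit of money, any other good at most `1`. -/
theorem eq_of_equalityEdge_inr (hU : 2 ≤ U) (hP : ∀ k, 1 ≤ P k) {k : Fin n} {g : Agent n}
    (h : EqualityEdge (utility n U) (blockPrice n P) (.inr k) g) : g = .inr k := by
  have hU' : (2 : ℝ) ≤ U := by exact_mod_cast hU
  have hk := h (.inr k)
  have h1 : utility n U (.inr k) (.inr k) = U := by simp [utility]
  rw [h1, show blockPrice n P (.inr k) = 1 from rfl, div_one] at hk
  rcases g with g | l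
  · have h2 : (utility n U (.inr k) (.inl g) : ℝ) ≤ 1 := by
      simp only [utility]; split_ifs <;> simp
    have h3 := div_le_self (Nat.cast_nonneg (α := ℝ) (utility n U (.inr k) (.inl g)))
      (one_le_blockPrice (n := n) hP (.inl g))
    linarith
  · by_contra hne
    have : utility n U (.inr k) (.inr l) = 0 := by
      simp only [utility]
      exact if_neg fun h => hne (by rw [h])
    rw [this, Nat.cast_zero, zero_div] at hk
    linarith

/-- The edges of the equality network that leave an agent of one of the blocks. -/
theorem equalityEdge_inl (hU : 2 ≤ U) (hP : ∀ k, 1 ≤ P k) {a : BlockAgent n} {g : Agent n}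
    (h : EqualityEdge (utility n U) (blockPrice n P) (.inl a) g) :
    ∃ b : BlockAgent n, g = .inl b ∧
      ((IsHigh b ∧ a.1 = b.1 ∧
          (IsHigh a → P (position n a.1) ≤ U * prevPrice P (position n a.1))) ∨
        (IsHigh b ∧ IsHigh a ∧ position n a.1 = position n b.1 + 1 ∧
          U * P (position n b.1) ≤ P (position n a.1)) ∨
        (¬ IsHigh b ∧ IsHigh a ∧ position n a.1 = 0 ∧ U ≤ P 0)) := by
  have hU0 : (0 : ℝ) < U := by exact_mod_cast (by omega : 0 < U)
  have hPp : ∀ k, 0 < P k := fun k => zero_lt_one.trans_le (hP k)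
  obtain ⟨c, hc, hch⟩ := exists_high a.1
  have hcown := h (.inl c)
  rw [utility_own hc.symm hch, blockPrice_high hch, hc] at hcown
  have hpos : 0 < (utility n U (.inl a) g : ℝ) / blockPrice n P g := by
    refine lt_of_lt_of_le ?_ hcown
    have := hPp (position n a.1)
    push_cast
    positivity
  have hne : utility n U (.inl a) g ≠ 0 := fun h0 => by simp [h0] at hpos
  rcases g with b | l
  · refine ⟨b, rfl, ?_⟩
    have hlow : IsHigh a → position n a.1 = 0 →
        2 ≤ (utility n U (.inl a) (.inl b) : ℝ) / blockPrice n P (.inl b) := by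
      intro ha h0
      obtain ⟨d, -, hd⟩ := exists_low a.1
      simpa [utility_first h0 ha hd, blockPrice_low hd] using h (.inl d)
    by_cases h1 : a.1 = b.1 ∧ IsHigh b
    · refine Or.inl ⟨h1.2, h1.1, fun ha => ?_⟩
      rcases Nat.eq_zero_or_pos (position n a.1) with h0 | h0
      · have := hlow ha h0
        rw [utility_own h1.1 h1.2, blockPrice_high h1.2, ← h1.1, le_div_iff₀ (hPp _)] at this
        push_cast at this
        rw [h0, prevPrice, mul_one]
        rw [h0] at this
        linarith
      · obtain ⟨k, hk⟩ := Nat.exists_eq_add_of_le' h0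
        obtain ⟨d, hd, hdk⟩ := exists_position_eq (n := n) (k := k)
          (by have := position_lt_card a.1.2; omega)
        obtain ⟨e, he, heh⟩ := exists_high ⟨d, hd⟩
        have hek : position n e.1 = k := by rw [he]; exact hdk
        have := h (.inl e)
        rw [utility_next (by omega) ha heh, utility_own h1.1 h1.2, blockPrice_high heh,
          blockPrice_high h1.2, ← h1.1, hek, div_le_div_iff₀ (hPp _) (hPp _)] at this
        push_cast at this
        rw [hk] at this ⊢
        rw [prevPrice]
        linarith
    · have hbr : (position n a.1 = 0 ∧ IsHigh a ∧ ¬ IsHigh b) ∨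
          (position n a.1 = position n b.1 + 1 ∧ IsHigh a ∧ IsHigh b) := by
        by_contra hn
        rw [not_or] at hn
        exact hne (by simp only [utility, if_neg h1, if_neg hn.1, if_neg hn.2])
      rcases hbr with ⟨h0, ha, hb⟩ | ⟨hk, ha, hb⟩
      · refine Or.inr (Or.inr ⟨hb, ha, h0, ?_⟩)
        rw [utility_first h0 ha hb, blockPrice_low hb, h0, div_le_div_iff₀ (hPp _) one_pos] at hcown
        push_cast at hcown
        linarith
      · refine Or.inr (Or.inl ⟨hb, ha, hk, ?_⟩)
        rw [utility_next hk ha hb, blockPrice_high hb, div_le_div_iff₀ (hPp _) (hPp _)] at hcown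
        push_cast at hcown
        linarith
  · exfalso
    -- Goods of the last block never attract these agents: a low-demand good, also at price `1`,
    -- gives utility `2` instead of `1`.
    by_cases h0 : position n a.1 = 0 ∧ IsHigh a
    · obtain ⟨d, -, hd⟩ := exists_low a.1
      have := h (.inl d)
      rw [utility_first h0.1 h0.2 hd, blockPrice_low hd,
        show blockPrice n P (.inr l) = 1 from rfl,
        show utility n U (.inl a) (.inr l) = 1 from if_pos h0] at this
      norm_num at this
    · exact hne (if_neg h0)

/-- A good that is not a low-demand good of one of the blocks. -/
def NotLow {n : ℕ} : Agent n → Prop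
  | .inl a => IsHigh a
  | .inr _ => True

variable {f : Agent n → Agent n → ℝ}

/-- A positive surplus would force the agent's own good to be sold out, but the agent is its only
buyer and the price equals its budget. -/
theorem surplus_inr (hU : 2 ≤ U) (hP : ∀ k, 1 ≤ P k)
    (hf : IsBalanced (utility n U) (blockPrice n P) f) (k : Fin n) :
    surplus (blockPrice n P) f (.inr k) = 0 := by
  by_contra hne
  have hr := (hf.1.surplus_nonneg (.inr k)).lt_of_ne' hne
  have : Nonempty (Agent n) := ⟨.inr k⟩
  obtain ⟨g, hg⟩ := exists_equalityEdge (utility n U) (blockPrice n P) (.inr k)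
  obtain rfl := eq_of_equalityEdge_inr hU hP hg
  have hsold := hf.sold_of_surplus_pos hg hr
  rw [Finset.sum_eq_single (.inr k)] at hsold
  · have h1 := Finset.single_le_sum (f := fun j => f (.inr k) j) (fun j _ => hf.1.nonneg (.inr k) j)
      (Finset.mem_univ (.inr k))
    rw [surplus] at hr
    linarith
  · intro i _ hi
    refine hf.1.support _ _ fun he => ?_
    rcases i with a | l
    · obtain ⟨b, hb, -⟩ := equalityEdge_inl hU hP he
      cases hb
    · exact hi (eq_of_equalityEdge_inr hU hP he).symm
  · intro h
    exact absurd (Finset.mem_univ _) h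

theorem surplus_congr (hf : IsBalanced (utility n U) (blockPrice n P) f) {a b : BlockAgent n}
    (h : a.1 = b.1) (hh : IsHigh a ↔ IsHigh b) :
    surplus (blockPrice n P) f (.inl a) = surplus (blockPrice n P) f (.inl b) := by
  have hp : blockPrice n P (.inl a) = blockPrice n P (.inl b) := by
    simp only [blockPrice]
    rw [h, propext hh]
  have hu := utility_congr_left (U := U) h hh
  refine (hf.surplus_le_of_edge hp.le fun j hj k => ?_).antisymm
    (hf.surplus_le_of_edge hp.ge fun j hj k => ?_)
  · rw [hu]; exact hj k
  · rw [← hu]; exact hj k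

/-- An agent interested in one low-demand good is interested in all of them. If it had positive
surplus, the goods of no interest to surplus agents would all be sold out by `g`, and
`surplus_eq_zero` would apply. This keeps low-demand prices at `1`. -/
theorem isHigh_of_equalityEdge (hU : 2 ≤ U) (hP : ∀ k, 1 ≤ P k)
    (hf : IsBalanced (utility n U) (blockPrice n P) f) {g : Agent n → Agent n → ℝ}
    (hg : IsFlow (utility n U) (blockPrice n P) g)
    (hs : ∀ j, NotLow j → ∑ i, g i j = blockPrice n P j) {a b : BlockAgent n}
    (hr : 0 < surplus (blockPrice n P) f (.inl a))
    (he : EqualityEdge (utility n U) (blockPrice n P) (.inl a) (.inl b)) : IsHigh b := by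
  by_contra hb
  obtain ⟨b', hbb, h⟩ := equalityEdge_inl hU hP he
  obtain rfl := Sum.inl_injective hbb
  obtain ⟨-, ha, h0, -⟩ := (h.resolve_left fun h => hb h.1).resolve_left fun h => hb h.1
  refine hr.ne' (hf.surplus_eq_zero hg (fun q hq => hs q ?_) _)
  rcases q with c | l
  · by_contra hc
    refine hq ⟨.inl a, hr, he.congr ?_ ?_⟩
    · rw [utility_first h0 ha hb, utility_first h0 ha hc]
    · rw [blockPrice_low hb, blockPrice_low hc]
  · trivial

/-- Under `hlt` the high-demand owners at position `k` prefer the cheaper competing goods. The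
high-demand goods at positions `≥ k` are then paid for by the high-demand owners at positions `> k`
and by low-demand owners. After cancellation, the goods at position `k` cost at most the budgets of
the latter, which are `1` each. -/
theorem price_le_card (hU : 2 ≤ U) (hP : ∀ k, 1 ≤ P k) {g : Agent n → Agent n → ℝ}
    (hg : IsFlow (utility n U) (blockPrice n P) g)
    (hs : ∀ j, NotLow j → ∑ i, g i j = blockPrice n P j) {k : ℕ} (hk : k < (blocks n).card)
    (hlt : U * prevPrice P k < P k) : P k ≤ Fintype.card (Agent n) := by
  classical
  let Q : Finset (Agent n) := Finset.univ.filter fun i => ∃ a : BlockAgent n,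
    i = .inl a ∧ IsHigh a ∧ k ≤ position n a.1
  let H : Finset (Agent n) := Finset.univ.filter fun i => ∃ a : BlockAgent n,
    i = .inl a ∧ IsHigh a ∧ k = position n a.1
  let L : Finset (Agent n) := Finset.univ.filter fun i => ∃ a : BlockAgent n,
    i = .inl a ∧ ¬ IsHigh a
  have hHQ : H ⊆ Q := fun i hi => by
    simp only [H, Q, Finset.mem_filter, Finset.mem_univ, true_and] at hi ⊢
    obtain ⟨a, h1, h2, h3⟩ := hi
    exact ⟨a, h1, h2, h3.le⟩
  have h1 : ∑ q ∈ Q, blockPrice n P q ≤ ∑ i ∈ (Q \ H) ∪ L, blockPrice n P i := by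
    refine hg.sum_price_le Q _ (fun q hq => hs q ?_) fun q hq i he => ?_
    · obtain ⟨-, a, rfl, ha, -⟩ := Finset.mem_filter.1 hq
      exact ha
    · obtain ⟨-, b, rfl, hb, hkb⟩ := Finset.mem_filter.1 hq
      rcases i with a | l
      · by_cases ha : IsHigh a
        · refine Finset.mem_union_left _ (Finset.mem_sdiff.2 ?_)
          obtain ⟨b', hbb, h⟩ := equalityEdge_inl hU hP he
          obtain rfl := Sum.inl_injective hbb
          rcases h with ⟨-, h, h'⟩ | ⟨-, -, h, -⟩ | ⟨h, -⟩
          · refine ⟨Finset.mem_filter.2 ⟨Finset.mem_univ _, a, rfl, ha, by rw [h]; exact hkb⟩, ?_⟩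
            intro hH
            obtain ⟨-, c, hc, -, hck⟩ := Finset.mem_filter.1 hH
            obtain rfl := Sum.inl_injective hc
            rw [hck] at hlt
            exact (h' ha).not_gt hlt
          · refine ⟨Finset.mem_filter.2 ⟨Finset.mem_univ _, a, rfl, ha, by omega⟩, ?_⟩
            intro hH
            obtain ⟨-, c, hc, -, hck⟩ := Finset.mem_filter.1 hH
            obtain rfl := Sum.inl_injective hc
            omega
          · exact absurd hb h
        · exact Finset.mem_union_right _ (Finset.mem_filter.2 ⟨Finset.mem_univ _, a, rfl, ha⟩)
      · exact absurd (eq_of_equalityEdge_inr hU hP he) (by simp)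
  have h2 : ∑ i ∈ (Q \ H) ∪ L, blockPrice n P i ≤
      ∑ i ∈ Q \ H, blockPrice n P i + ∑ i ∈ L, blockPrice n P i := by
    rw [← Finset.sum_union_inter]
    exact le_add_of_nonneg_right (Finset.sum_nonneg fun i _ => (blockPrice_pos hP i).le)
  have h3 := Finset.sum_sdiff (f := blockPrice n P) hHQ
  have h4 : ∑ i ∈ L, blockPrice n P i ≤ Fintype.card (Agent n) := by
    have : ∀ i ∈ L, blockPrice n P i = 1 := fun i hi => by
      obtain ⟨-, a, rfl, ha⟩ := Finset.mem_filter.1 hi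
      exact blockPrice_low ha
    rw [Finset.sum_congr rfl this, Finset.sum_const, nsmul_eq_mul, mul_one]
    exact_mod_cast Finset.card_le_univ L
  obtain ⟨b, hb, hbk⟩ := exists_position_eq hk
  obtain ⟨a, hab, ha⟩ := exists_high ⟨b, hb⟩
  have hak : position n a.1 = k := by rw [hab]; exact hbk
  have h5 : P k ≤ ∑ i ∈ H, blockPrice n P i := by
    have := Finset.single_le_sum (f := blockPrice n P) (s := H) (a := .inl a)
      (fun i _ => (blockPrice_pos hP i).le)
      (Finset.mem_filter.2 ⟨Finset.mem_univ _, a, rfl, ha, hak.symm⟩)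
    rwa [blockPrice_high ha, hak] at this
  linarith

theorem price_le_pow (hU : 2 ≤ U) (hP : ∀ k, 1 ≤ P k) {g : Agent n → Agent n → ℝ}
    (hg : IsFlow (utility n U) (blockPrice n P) g)
    (hs : ∀ j, NotLow j → ∑ i, g i j = blockPrice n P j) (hn : 1 ≤ n) {k : ℕ}
    (hk : k < (blocks n).card) : P k ≤ Fintype.card (Agent n) * (U : ℝ) ^ (k + 1) := by
  have hN : (1 : ℝ) ≤ Fintype.card (Agent n) := by exact_mod_cast one_le_card_agent hn
  have hU1 : (1 : ℝ) ≤ U := by exact_mod_cast (by omega : 1 ≤ U)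
  induction k with
  | zero =>
    by_cases h : U * prevPrice P 0 < P 0
    · have := price_le_card hU hP hg hs hk h
      rw [zero_add, pow_one]
      nlinarith
    · rw [prevPrice] at h
      rw [zero_add, pow_one]
      nlinarith
  | succ k ih =>
    by_cases h : U * prevPrice P (k + 1) < P (k + 1)
    · have := price_le_card hU hP hg hs hk h
      exact this.trans (le_mul_of_one_le_right (by linarith) (one_le_pow₀ hU1))
    · rw [prevPrice] at h
      have h1 := ih (by omega)
      calc P (k + 1) ≤ U * P k := not_lt.1 h
        _ ≤ U * (Fintype.card (Agent n) * (U : ℝ) ^ (k + 1)) :=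
            mul_le_mul_of_nonneg_left h1 (by linarith)
        _ = _ := by ring

/-- The surplus of the agents of a block that trades with no other block. -/
theorem surplus_eq_ratio (hU : 2 ≤ U) (hP : ∀ k, 1 ≤ P k)
    (hf : IsBalanced (utility n U) (blockPrice n P) f) (a : BlockAgent n)
    (h1 : P (position n a.1) < U * prevPrice P (position n a.1))
    (h2 : P (position n a.1 + 1) < U * P (position n a.1)) :
    surplus (blockPrice n P) f (.inl a) = (ratio a.1 : ℝ) := by
  classical
  obtain ⟨b, t₀⟩ := a
  simp only at h1 h2 ⊢
  obtain ⟨-, hbp, -, hb1, hb2⟩ := mem_blocks_iff.1 b.2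
  let φ : Fin b.1.1 → Agent n := fun t => .inl ⟨b, t⟩
  have hφ : Function.Injective φ := fun s t h => by simpa [φ] using h
  have hhigh : ∀ t, IsHigh (⟨b, t⟩ : BlockAgent n) ↔ t.1 < b.1.2 := fun t => Iff.rfl
  have hedge : ∀ t g, EqualityEdge (utility n U) (blockPrice n P) (φ t) g →
      ∃ s, g = φ s ∧ s.1 < b.1.2 := by
    intro t g he
    obtain ⟨⟨c, s⟩, rfl, h⟩ := equalityEdge_inl hU hP he
    rcases h with ⟨hs, rfl, -⟩ | ⟨-, -, h, h'⟩ | ⟨-, -, h, h'⟩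
    · exact ⟨s, rfl, hs⟩
    · rw [h, prevPrice] at h1
      rw [h] at h'
      exact absurd h1 h'.not_gt
    · rw [h, prevPrice, mul_one] at h1
      exact absurd h1 h'.not_gt
  have hedge' : ∀ t s : Fin b.1.1, s.1 < b.1.2 →
      EqualityEdge (utility n U) (blockPrice n P) (φ t) (φ s) := by
    intro t s hs
    have : Nonempty (Agent n) := ⟨φ t⟩
    obtain ⟨g, hg⟩ := exists_equalityEdge (utility n U) (blockPrice n P) (φ t)
    obtain ⟨s', rfl, hs'⟩ := hedge t g hg
    have hh : IsHigh (⟨b, s'⟩ : BlockAgent n) ↔ IsHigh (⟨b, s⟩ : BlockAgent n) :=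
      iff_of_true hs' hs
    refine hg.congr (utility_congr_right _ rfl hh) ?_
    simp only [φ, blockPrice_high (P := P) ((hhigh s).2 hs),
      blockPrice_high (P := P) ((hhigh s').2 hs')]
  have hback : ∀ (s : Fin b.1.1) i, s.1 < b.1.2 →
      EqualityEdge (utility n U) (blockPrice n P) i (φ s) → i ∈ Set.range φ := by
    intro s i hs he
    rcases i with ⟨c, t⟩ | l
    · obtain ⟨b', hbb, h⟩ := equalityEdge_inl hU hP he
      obtain rfl := Sum.inl_injective hbb
      rcases h with ⟨-, rfl, -⟩ | ⟨-, -, h, h'⟩ | ⟨h, -⟩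
      · exact ⟨t, rfl⟩
      · rw [h] at h'
        exact absurd h2 h'.not_gt
      · exact absurd hs h
    · exact absurd (eq_of_equalityEdge_inr hU hP he) (by simp [φ])
  set p := blockPrice n P with hp
  have hpφ : ∀ t : Fin b.1.1, 1 ≤ p (φ t) := fun t => one_le_blockPrice hP _
  have hrow : ∀ t, ∑ g, f (φ t) g = ∑ s, f (φ t) (φ s) := fun t =>
    (Fintype.sum_of_injective φ hφ _ _ (fun g hg => hf.1.support _ _ fun he =>
      hg (by obtain ⟨s, rfl, -⟩ := hedge t g he; exact ⟨s, rfl⟩)) fun _ => rfl).symm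
  have hcol : ∀ s : Fin b.1.1, s.1 < b.1.2 → ∑ i, f i (φ s) = ∑ t, f (φ t) (φ s) := fun s hs =>
    (Fintype.sum_of_injective φ hφ _ _ (fun i hi => hf.1.support _ _ fun he =>
      hi (hback s i hs he)) fun _ => rfl).symm
  have hcol0 : ∀ s : Fin b.1.1, ¬ s.1 < b.1.2 → ∑ t, f (φ t) (φ s) = 0 := fun s hs =>
    Finset.sum_eq_zero fun t _ => hf.1.support _ _ fun he => by
      obtain ⟨s', h, hs'⟩ := hedge t _ he
      exact hs (hφ h ▸ hs')
  -- The block is closed under trade, so unspent money equals the value of unsold goods.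
  have htotal : ∑ t, surplus p f (φ t) = ∑ s, (p (φ s) - ∑ t, f (φ t) (φ s)) := by
    simp only [surplus, hrow, Finset.sum_sub_distrib]
    rw [Finset.sum_comm]
  have hcount : ∑ s : Fin b.1.1, (if s.1 < b.1.2 then (0 : ℝ) else 1) = (b.1.1 : ℝ) - b.1.2 := by
    rw [Finset.sum_ite, Finset.sum_const_zero, zero_add, Finset.sum_const, nsmul_eq_mul, mul_one,
      eq_sub_iff_add_eq]
    have h := Finset.card_filter_add_card_filter_not (s := Finset.univ)
      (fun s : Fin b.1.1 => s.1 < b.1.2)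
    rw [Fin.card_filter_val_lt, Finset.card_univ, Fintype.card_fin, min_eq_right hb2.le] at h
    rw [add_comm]
    exact_mod_cast h
  have hb0 : (0 : ℝ) < b.1.1 := by exact_mod_cast hbp.pos
  have hb1' : (1 : ℝ) ≤ b.1.2 := by exact_mod_cast hb1
  have hb2' : (b.1.2 : ℝ) < b.1.1 := by exact_mod_cast hb2
  have hlow : ∀ s : Fin b.1.1, ¬ s.1 < b.1.2 → p (φ s) = 1 := fun s hs =>
    blockPrice_low (P := P) (a := ⟨b, s⟩) hs
  -- The unsold low-demand goods alone give positive total surplus; an agent with positive surplus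
  -- then forces the high-demand goods to be sold out.
  have hpos : 0 < ∑ t, surplus p f (φ t) := by
    rw [htotal]
    refine lt_of_lt_of_le (sub_pos.2 hb2') (hcount ▸ Finset.sum_le_sum fun s _ => ?_)
    split_ifs with hs
    · rw [← hcol s hs, sub_nonneg]
      exact hf.1.supply _
    · rw [hcol0 s hs, hlow s hs, sub_zero]
  obtain ⟨t₁, -, ht₁⟩ := Finset.exists_lt_of_sum_lt (s := Finset.univ) (f := fun _ => (0 : ℝ))
    (g := fun t => surplus p f (φ t)) (by simpa using hpos)
  have hsum : ∑ t, surplus p f (φ t) = (b.1.1 : ℝ) - b.1.2 := by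
    rw [htotal, ← hcount]
    refine Finset.sum_congr rfl fun s _ => ?_
    split_ifs with hs
    · rw [← hcol s hs, hf.sold_of_surplus_pos (hedge' t₁ s hs) ht₁, sub_self]
    · rw [hcol0 s hs, hlow s hs, sub_zero]
  obtain ⟨t₂, -, ht₂⟩ := Finset.exists_min_image Finset.univ (fun t => surplus p f (φ t))
    ⟨t₀, Finset.mem_univ _⟩
  have hle : ∀ t, surplus p f (φ t) ≤ surplus p f (φ t₂) := by
    intro t
    by_cases h : surplus p f (φ t₂) < p (φ t₂)
    · obtain ⟨g, hg, hge⟩ := hf.1.sum_pos h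
      obtain ⟨s, rfl, hs⟩ := hedge t₂ g hge
      exact hf.surplus_le_of_flow_pos (hedge' t s hs) hg
    -- If an agent of least surplus spent nothing, all surpluses would be at least `1` and would sum
    -- to at least `i > i - j`.
    · exfalso
      have : ∑ t : Fin b.1.1, (1 : ℝ) ≤ ∑ t, surplus p f (φ t) := Finset.sum_le_sum fun t _ =>
        ((hpφ t₂).trans (not_lt.1 h)).trans (ht₂ t (Finset.mem_univ t))
      rw [hsum] at this
      simp at this
      linarith
  have heq : ∀ t, surplus p f (φ t) = surplus p f (φ t₀) := fun t =>
    ((hle t).trans (ht₂ t₀ (Finset.mem_univ _))).antisymm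
      ((hle t₀).trans (ht₂ t (Finset.mem_univ _)))
  rw [Finset.sum_congr rfl fun t _ => heq t] at hsum
  simp only [Finset.sum_const, Finset.card_univ, Fintype.card_fin, nsmul_eq_mul] at hsum
  have hr : (ratio b.1 : ℝ) = ((b.1.1 : ℝ) - b.1.2) / b.1.1 := by simp [ratio]
  rw [hr, eq_div_iff hb0.ne', mul_comm]
  exact hsum

end Edges

/-! ### Invariant, potential and the effect of one iteration -/

section Step

variable {n U : ℕ} {P : ℕ → ℝ} {p : Agent n → ℝ} {f : Agent n → Agent n → ℝ}

/-- The invariant of the main loop. -/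
structure Inv (n U : ℕ) (P : ℕ → ℝ) (p : Agent n → ℝ) : Prop where
  price : p = blockPrice n P
  one_le : ∀ k, 1 ≤ P k
  sold : ∃ g, IsFlow (utility n U) p g ∧ ∀ j, NotLow j → ∑ i, g i j = p j
  -- After the first block below target, prices do not increase with the position; hence all later
  -- blocks are below target too.
  frontier : ∀ k s, k < s → P k < (U : ℝ) ^ (k + 1) → P s ≤ P (s - 1)

theorem Inv.lt_pow_of_le (h : Inv n U P p) (hU : 2 ≤ U) {k s : ℕ} (hks : k ≤ s)
    (hk : P k < (U : ℝ) ^ (k + 1)) : P s < (U : ℝ) ^ (s + 1) := by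
  have hU1 : (1 : ℝ) ≤ U := by exact_mod_cast (by omega : 1 ≤ U)
  induction s, hks using Nat.le_induction with
  | base => exact hk
  | succ s hs ih =>
    exact ((h.frontier k (s + 1) (by omega) hk).trans_lt ih).trans_le
      (pow_le_pow_right₀ hU1 (by omega))

/-- Either the previous block is below target and `frontier` applies, or its price is at least `U ^
k`. Together with `Inv.succ_lt` this isolates a block below target from both neighbours. -/
theorem Inv.lt_prevPrice (h : Inv n U P p) (hU : 2 ≤ U) {k : ℕ}
    (hk : P k < (U : ℝ) ^ (k + 1)) : P k < U * prevPrice P k := by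
  have hU1 : (1 : ℝ) < U := by exact_mod_cast (by omega : 1 < U)
  rcases k with _ | k
  · simpa [prevPrice] using hk
  · rw [prevPrice]
    by_cases hF : P k < (U : ℝ) ^ (k + 1)
    · have h1 := h.frontier k (k + 1) (by omega) hF
      have h2 := h.one_le k
      rw [Nat.add_sub_cancel] at h1
      nlinarith
    · refine hk.trans_le ?_
      rw [pow_succ' _ (k + 1)]
      exact mul_le_mul_of_nonneg_left (not_lt.1 hF) (by linarith)

theorem Inv.succ_lt (h : Inv n U P p) (hU : 2 ≤ U) {k : ℕ}
    (hk : P k < (U : ℝ) ^ (k + 1)) : P (k + 1) < U * P k := by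
  have hU1 : (1 : ℝ) < U := by exact_mod_cast (by omega : 1 < U)
  have h1 := h.frontier k (k + 1) (by omega) hk
  have h2 := h.one_le k
  rw [Nat.add_sub_cancel] at h1
  nlinarith

theorem Inv.surplus_eq (h : Inv n U P p) (hU : 2 ≤ U) (hf : IsBalanced (utility n U) p f)
    (a : BlockAgent n) (ha : P (position n a.1) < (U : ℝ) ^ (position n a.1 + 1)) :
    surplus p f (.inl a) = (ratio a.1 : ℝ) := by
  obtain rfl := h.price
  exact surplus_eq_ratio hU h.one_le hf a (h.lt_prevPrice hU ha) (h.succ_lt hU ha)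

/-- The contribution of a block with price `exp y` to the potential, where `a` is the value that `y`
has to reach. -/
noncomputable def phase (a y : ℝ) : ℝ := min y a - 3 * max (y - a) 0

theorem phase_add_le {a y w : ℝ} (hw : 0 ≤ w) : phase a (w + y) ≤ phase a y + w := by
  unfold phase
  have h1 : min (w + y) a ≤ min y a + w := by
    rw [← min_add_add_right, add_comm y]
    exact min_le_min le_rfl (by linarith)
  have h2 : max (y - a) 0 ≤ max (w + y - a) 0 := max_le_max (by linarith) le_rfl
  linarith

theorem phase_add_of_le {a y w : ℝ} (hw : 0 ≤ w) (hy : a ≤ y) :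
    phase a (w + y) = phase a y - 3 * w := by
  unfold phase
  rw [min_eq_right hy, min_eq_right (by linarith), max_eq_left (by linarith),
    max_eq_left (by linarith)]
  ring

/-- The sum of the contributions of all blocks. -/
noncomputable def potential (n U : ℕ) (P : ℕ → ℝ) : ℝ :=
  ∑ k ∈ Finset.range (blocks n).card, phase ((k + 1) * Real.log U) (Real.log (P k))

theorem lt_pow_iff_log_lt (hU : 2 ≤ U) {k : ℕ} {y : ℝ} (hy : 0 < y) :
    y < (U : ℝ) ^ (k + 1) ↔ Real.log y < (k + 1) * Real.log U := by
  have hU0 : (0 : ℝ) < U := by exact_mod_cast (by omega : 0 < U)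
  rw [← Real.log_lt_log_iff hy (by positivity), Real.log_pow]
  push_cast
  rfl

/-- The prices of the high-demand goods of the block at position `k` rise. -/
def Rises (G : Set (Agent n)) (k : ℕ) : Prop :=
  ∃ a : BlockAgent n, IsHigh a ∧ position n a.1 = k ∧ .inl a ∈ G

variable {S : Set (Agent n)}

theorem mem_neighbors_inl (hU : 2 ≤ U) (h : Inv n U P p) (hf : IsBalanced (utility n U) p f)
    (hS : ∀ i ∈ S, 0 < surplus p f i) {g : Agent n} (hg : g ∈ neighbors (utility n U) p S) :
    ∃ a b : BlockAgent n, .inl a ∈ S ∧ g = .inl b ∧ IsHigh b ∧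
      EqualityEdge (utility n U) p (.inl a) (.inl b) := by
  obtain rfl := h.price
  obtain ⟨i, hi, he⟩ := hg
  rcases i with a | k
  · obtain ⟨b, rfl, -⟩ := equalityEdge_inl hU h.one_le he
    obtain ⟨g₀, hg₀, hs⟩ := h.sold
    exact ⟨a, b, hi, rfl, isHigh_of_equalityEdge hU h.one_le hf hg₀ hs (hS _ hi) he, he⟩
  · exact absurd (surplus_inr hU h.one_le hf k) (hS _ hi).ne'

theorem mem_neighbors_iff_rises (hU : 2 ≤ U) (h : Inv n U P p) (hf : IsBalanced (utility n U) p f)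
    (hS : ∀ i ∈ S, 0 < surplus p f i) {b : BlockAgent n} (hb : IsHigh b) :
    .inl b ∈ neighbors (utility n U) p S ↔
      Rises (neighbors (utility n U) p S) (position n b.1) := by
  refine ⟨fun hbG => ⟨b, hb, rfl, hbG⟩, fun ⟨c, hc, hcb, hcG⟩ => ?_⟩
  have hcb' := fst_eq_of_position_eq hcb
  obtain ⟨a, c', haS, hcc, -, he⟩ := mem_neighbors_inl hU h hf hS hcG
  obtain rfl := Sum.inl_injective hcc
  refine ⟨.inl a, haS, he.congr (utility_congr_right _ hcb' (iff_of_true hc hb)) ?_⟩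
  rw [h.price, blockPrice_high hc, blockPrice_high hb, hcb]

/-- An agent of `S` raises the price of what it wants: high-demand goods of its own block or of the
preceding one. -/
theorem rises_of_mem (hU : 2 ≤ U) (h : Inv n U P p) (hf : IsBalanced (utility n U) p f)
    (hS : ∀ i ∈ S, 0 < surplus p f i) {a : BlockAgent n} (ha : .inl a ∈ S) :
    Rises (neighbors (utility n U) p S) (position n a.1) ∨
      (IsHigh a ∧ ∃ l, position n a.1 = l + 1 ∧ U * P l ≤ P (l + 1) ∧
        Rises (neighbors (utility n U) p S) l) := by
  have : Nonempty (Agent n) := ⟨.inl a⟩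
  obtain ⟨g, hg⟩ := exists_equalityEdge (utility n U) p (.inl a)
  have hgG : g ∈ neighbors (utility n U) p S := ⟨_, ha, hg⟩
  obtain ⟨-, b, -, rfl, hb, -⟩ := mem_neighbors_inl hU h hf hS hgG
  rw [h.price] at hg
  obtain ⟨b', hbb, hc⟩ := equalityEdge_inl hU h.one_le hg
  obtain rfl := Sum.inl_injective hbb
  rcases hc with ⟨-, hab, -⟩ | ⟨-, ha', hab, hle⟩ | ⟨hb', -⟩
  · exact Or.inl ⟨b, hb, by rw [hab], hgG⟩
  · rw [hab] at hle
    exact Or.inr ⟨ha', _, hab, hle, b, hb, rfl, hgG⟩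
  · exact absurd hb hb'

theorem rises_of_mem_of_lt (hU : 2 ≤ U) (h : Inv n U P p) (hf : IsBalanced (utility n U) p f)
    (hS : ∀ i ∈ S, 0 < surplus p f i) {a : BlockAgent n} (ha : .inl a ∈ S)
    (hlt : P (position n a.1) < (U : ℝ) ^ (position n a.1 + 1)) :
    Rises (neighbors (utility n U) p S) (position n a.1) := by
  refine (rises_of_mem hU h hf hS ha).resolve_right ?_
  rintro ⟨-, l, hl, hle, -⟩
  have := h.lt_prevPrice hU hlt
  rw [hl, prevPrice] at this
  exact hle.not_gt this

theorem exists_mem_of_rises (hU : 2 ≤ U) (h : Inv n U P p) (hf : IsBalanced (utility n U) p f)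
    (hS : ∀ i ∈ S, 0 < surplus p f i) {k : ℕ} (hk : Rises (neighbors (utility n U) p S) k)
    (hlt : P k < (U : ℝ) ^ (k + 1)) : ∃ a : BlockAgent n, position n a.1 = k ∧ .inl a ∈ S := by
  obtain ⟨b, hb, rfl, hbG⟩ := hk
  obtain ⟨a, b', haS, hbb, -, he⟩ := mem_neighbors_inl hU h hf hS hbG
  obtain rfl := Sum.inl_injective hbb
  rw [h.price] at he
  obtain ⟨b', hbb, hc⟩ := equalityEdge_inl hU h.one_le he
  obtain rfl := Sum.inl_injective hbb
  rcases hc with ⟨-, hab, -⟩ | ⟨-, -, hab, hle⟩ | ⟨hb', -⟩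
  · exact ⟨a, by rw [hab], haS⟩
  · rw [hab] at hle
    exact absurd (h.succ_lt hU hlt) hle.not_gt
  · exact absurd hb hb'

/-- Below target, surpluses are the ratios, which decrease with the position; so `S` contains the
agents at `s - 1` whenever it contains one at `s`. This preserves `frontier`. -/
theorem rises_pred (hU : 2 ≤ U) (h : Inv n U P p) (hf : IsBalanced (utility n U) p f)
    (hS : ∀ i ∈ S, 0 < surplus p f i)
    (hup : ∀ i ∈ S, ∀ j, surplus p f i ≤ surplus p f j → j ∈ S) {k s : ℕ} (hks : k < s)
    (hk : P k < (U : ℝ) ^ (k + 1)) (hs : Rises (neighbors (utility n U) p S) s) :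
    Rises (neighbors (utility n U) p S) (s - 1) := by
  have hsF := h.lt_pow_of_le hU hks.le hk
  have hsF' := h.lt_pow_of_le hU (by omega : k ≤ s - 1) hk
  obtain ⟨a, rfl, haS⟩ := exists_mem_of_rises hU h hf hS hs hsF
  obtain ⟨d, hd, hdk⟩ := exists_position_eq (n := n) (k := position n a.1 - 1)
    (by have := position_lt_card a.1.2; omega)
  obtain ⟨c, hc, -⟩ := exists_high ⟨d, hd⟩
  have hcd : position n c.1 = position n a.1 - 1 := by rw [hc]; exact hdk
  rw [← hcd] at hsF' ⊢
  refine rises_of_mem_of_lt hU h hf hS (hup _ haS _ ?_) hsF'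
  rw [h.surplus_eq hU hf a hsF, h.surplus_eq hU hf c hsF']
  exact_mod_cast (ratio_lt_of_position_lt (by omega : position n c.1 < position n a.1)).le

open Classical in
/-- In an iteration that raises many prices below their target values, a proportional number of prices
above their target values rises too, as the agents in between have to be of high surplus. -/
theorem card_rises_le (hU : 2 ≤ U) (h : Inv n U P p) (hf : IsBalanced (utility n U) p f)
    (hr : 0 < surplusNorm p f) (G : Set (Agent n))
    (hG : G = neighbors (utility n U) p (highSurplus (surplus p f))) :
    ((Finset.range (blocks n).card).filter fun k => Rises G k ∧ P k < (U : ℝ) ^ (k + 1)).card ≤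
      1 + 3 * ((Finset.range (blocks n).card).filter fun k =>
        Rises G k ∧ ¬ P k < (U : ℝ) ^ (k + 1)).card := by
  subst hG
  set S := highSurplus (surplus p f) with hSdef
  set G := neighbors (utility n U) p S with hG
  have hS : ∀ i ∈ S, 0 < surplus p f i := fun i hi =>
    pos_of_mem_highSurplus hf.1.surplus_nonneg (exists_surplus_pos hf.1 hr) hi
  set A := (Finset.range (blocks n).card).filter fun k => Rises G k ∧ P k < (U : ℝ) ^ (k + 1)
    with hA
  set B := (Finset.range (blocks n).card).filter fun k => Rises G k ∧ ¬ P k < (U : ℝ) ^ (k + 1)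
    with hB
  rcases A.eq_empty_or_nonempty with hA0 | hA0
  · simp [hA0]
  have hs₀ := A.min'_mem hA0
  set s₀ := A.min' hA0 with hs₀def
  rw [hA, Finset.mem_filter] at hs₀
  obtain ⟨-, -, hF₀⟩ := hs₀
  have hF : ∀ s, s₀ ≤ s → P s < (U : ℝ) ^ (s + 1) := fun s hs => h.lt_pow_of_le hU hs hF₀
  -- `R s (l, t)`: a surplus strictly between the ratios at `s` and `s - 1` is attained by an agent
  -- of kind `t` attached to block `l`: a low-demand owner of `l`, a high-demand owner of `l`, or
  -- one of `l + 1`.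
  let R : ℕ → ℕ × ℕ → Prop := fun s lt => ∃ j c d : BlockAgent n,
    position n c.1 = s ∧ position n d.1 = s - 1 ∧
    (ratio c.1 : ℝ) < surplus p f (.inl j) ∧ surplus p f (.inl j) < (ratio d.1 : ℝ) ∧
    ((lt.2 = 0 ∧ ¬ IsHigh j ∧ position n j.1 = lt.1) ∨
      (lt.2 = 1 ∧ IsHigh j ∧ position n j.1 = lt.1) ∨
      (lt.2 = 2 ∧ IsHigh j ∧ position n j.1 = lt.1 + 1))
  have key : (A.erase s₀).card ≤ (B ×ˢ Finset.range 3).card := by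
    refine Finset.card_le_card_of_forall_subsingleton R (fun s hs => ?_) (fun lt _ => ?_)
    · obtain ⟨hne, hsA⟩ := Finset.mem_erase.1 hs
      have hlt : s₀ < s := lt_of_le_of_ne (A.min'_le s hsA) hne.symm
      rw [hA, Finset.mem_filter] at hsA
      obtain ⟨hsr, hsR, hsF⟩ := hsA
      obtain ⟨c, hcs, hcS⟩ := exists_mem_of_rises hU h hf hS hsR hsF
      obtain ⟨d', hd', hdk⟩ := exists_position_eq (n := n) (k := s - 1)
        (by have := Finset.mem_range.1 hsr; omega)
      obtain ⟨d, hdd, -⟩ := exists_high ⟨d', hd'⟩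
      have hds : position n d.1 = s - 1 := by rw [hdd]; exact hdk
      have hrc := h.surplus_eq hU hf c (by rw [hcs]; exact hsF)
      have hrd := h.surplus_eq hU hf d (by rw [hds]; exact hF _ (by omega))
      have hrat : ratio c.1 < ratio d.1 :=
        ratio_lt_of_position_lt (by omega : position n d.1 < position n c.1)
      obtain ⟨j, hj1, hj2⟩ := exists_between_of_mem_highSurplus hcS (i := .inl d)
        (by rw [hrc, hrd]; exact_mod_cast hrat)
        (by rw [hrc, hrd]; exact ratio_gap d.1.2 c.1.2 hrat)
      have hjS : j ∈ S := mem_highSurplus_of_le hcS hj1.le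
      rcases j with j | l
      swap
      · have := h.price
        subst this
        exact absurd (surplus_inr hU h.one_le hf l) (hS _ hjS).ne'
      rw [hrc] at hj1
      rw [hrd] at hj2
      -- From `s₀` on, surpluses are ratios, and no ratio lies strictly between two consecutive
      -- ones.
      have hjlt : position n j.1 < s₀ := by
        by_contra! hle
        rw [h.surplus_eq hU hf j (hF _ hle)] at hj1 hj2
        have h1 : ¬ position n c.1 ≤ position n j.1 := fun hle' => by
          rcases hle'.lt_or_eq with h' | h'
          · exact (ratio_lt_of_position_lt h').not_gt (by exact_mod_cast hj1)
          · rw [position_injOn c.1.2 j.1.2 h'] at hj1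
            exact lt_irrefl _ hj1
        have h2 : ¬ position n j.1 ≤ position n d.1 := fun hle' => by
          rcases hle'.lt_or_eq with h' | h'
          · exact (ratio_lt_of_position_lt h').not_gt (by exact_mod_cast hj2)
          · rw [position_injOn j.1.2 d.1.2 h'] at hj2
            exact lt_irrefl _ hj2
        omega
      have hjF : ¬ P (position n j.1) < (U : ℝ) ^ (position n j.1 + 1) := by
        intro hjF
        have hjr := rises_of_mem_of_lt hU h hf hS hjS hjF
        have : position n j.1 ∈ A := by
          rw [hA, Finset.mem_filter]
          exact ⟨Finset.mem_range.2 (position_lt_card j.1.2), hjr, hjF⟩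
        exact (A.min'_le _ this).not_gt hjlt
      rcases rises_of_mem hU h hf hS hjS with hR | ⟨hjh, l, hl, -, hR⟩
      · have hmem : position n j.1 ∈ B := by
          rw [hB, Finset.mem_filter]
          exact ⟨Finset.mem_range.2 (position_lt_card j.1.2), hR, hjF⟩
        by_cases hjh : IsHigh j
        · exact ⟨(position n j.1, 1), by simp [hmem],
            j, c, d, hcs, hds, hj1, hj2, Or.inr (Or.inl ⟨rfl, hjh, rfl⟩)⟩
        · exact ⟨(position n j.1, 0), by simp [hmem],
            j, c, d, hcs, hds, hj1, hj2, Or.inl ⟨rfl, hjh, rfl⟩⟩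
      · have hmem : l ∈ B := by
          rw [hB, Finset.mem_filter]
          refine ⟨Finset.mem_range.2 ?_, hR, fun hlF => hjF (h.lt_pow_of_le hU (by omega) hlF)⟩
          have := position_lt_card j.1.2
          omega
        exact ⟨(l, 2), by simp [hmem],
          j, c, d, hcs, hds, hj1, hj2, Or.inr (Or.inr ⟨rfl, hjh, hl⟩)⟩
    -- The pair `(l, t)` determines the surplus, and the open intervals between consecutive ratios
    -- are disjoint.
    · have main : ∀ s s', R s lt → R s' lt → ¬ s < s' := by
        rintro s s' ⟨j, c, d, hc, hd, h1, h2, h3⟩ ⟨j', c', d', hc', hd', h1', h2', h3'⟩ hss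
        have hjj : surplus p f (.inl j) = surplus p f (.inl j') := by
          have := h.price
          subst this
          refine surplus_congr hf (fst_eq_of_position_eq ?_) ?_
          · omega
          · rcases h3 with h3 | h3 | h3 <;> rcases h3' with h3' | h3' | h3' <;>
              first
              | exact iff_of_true h3.2.1 h3'.2.1
              | exact iff_of_false h3.2.1 h3'.2.1
              | omega
        rw [hjj] at h1
        have : ratio c.1 < ratio d'.1 := by exact_mod_cast h1.trans h2'
        have := position_lt_position (n := n) d'.1.2 this
        omega
      intro s hs s' hs'
      exact le_antisymm (not_lt.1 (main s' s hs'.2 hs.2)) (not_lt.1 (main s s' hs.2 hs'.2))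
  rw [Finset.card_product, Finset.card_range] at key
  have : (A.erase s₀).card + 1 = A.card := Finset.card_erase_add_one (A.min'_mem hA0)
  omega

/-- One iteration preserves the invariant and increases the potential by at most the logarithm of the
maximum factor. -/
theorem Inv.step (hU : 2 ≤ U) (h : Inv n U P p) (hf : IsBalanced (utility n U) p f)
    (hr : 0 < surplusNorm p f) :
    ∃ P', Inv n U P' (updatePrice (utility n U) p f) ∧
      potential n U P' ≤ potential n U P + Real.log (xMax (Agent n)) := by
  classical
  have hp0 : ∀ j, 0 < p j := by
    rw [h.price]
    exact blockPrice_pos h.one_le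
  set S := highSurplus (surplus p f) with hSdef
  set G := neighbors (utility n U) p S with hG
  set x := updateFactor (utility n U) p f S G with hx
  have hup : updatePrice (utility n U) p f = scalePrice G x p := rfl
  have hS : ∀ i ∈ S, 0 < surplus p f i := fun i hi =>
    pos_of_mem_highSurplus hf.1.surplus_nonneg (exists_surplus_pos hf.1 hr) hi
  have hSup : ∀ i ∈ S, ∀ j, surplus p f i ≤ surplus p f j → j ∈ S := fun i hi j hij =>
    mem_highSurplus_of_le hi hij
  have hx1 : 1 ≤ x := one_le_updateFactor hp0
  have hxm : x ≤ xMax (Agent n) := updateFactor_le_xMax hp0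
  have hP0 : ∀ k, 0 < P k := fun k => zero_lt_one.trans_le (h.one_le k)
  let P' : ℕ → ℝ := fun k => if Rises G k then x * P k else P k
  have hPP' : ∀ k, P k ≤ P' k := fun k => by
    simp only [P']
    split_ifs
    · exact le_mul_of_one_le_left (hP0 k).le hx1
    · exact le_rfl
  have hnotG : ∀ g, ¬ (∃ b : BlockAgent n, g = .inl b ∧ IsHigh b) → g ∉ G := fun g hg hgG => by
    obtain ⟨-, b, -, hb, hbh, -⟩ := mem_neighbors_inl hU h hf hS hgG
    exact hg ⟨b, hb, hbh⟩
  refine ⟨P', ⟨?_, fun k => (h.one_le k).trans (hPP' k), ?_, ?_⟩, ?_⟩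
  · funext g
    rw [hup]
    rcases g with b | l
    · by_cases hb : IsHigh b
      · rw [blockPrice_high hb, scalePrice, h.price, blockPrice_high hb]
        exact if_congr (mem_neighbors_iff_rises hU h hf hS hb) rfl rfl
      · have : (.inl b : Agent n) ∉ G := hnotG _ fun ⟨c, hc, hch⟩ =>
          hb (Sum.inl_injective hc ▸ hch)
        rw [scalePrice, if_neg this, h.price, blockPrice_low hb, blockPrice_low hb]
    · have : (.inr l : Agent n) ∉ G := hnotG _ fun ⟨c, hc, _⟩ => by cases hc
      rw [scalePrice, if_neg this, h.price]
      rfl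
  · obtain ⟨g, hg, hs⟩ := h.sold
    obtain ⟨g', hg', hs'⟩ := hf.exists_flow_updatePrice hp0 hr hg
    exact ⟨g', hg', fun j hj => hs' j (hs j hj)⟩
  · intro k s hks hk
    have hk' := (hPP' k).trans_lt hk
    have hle := h.frontier k s hks hk'
    by_cases hsR : Rises G s
    · have hsR' : Rises G (s - 1) := rises_pred hU h hf hS hSup hks hk' hsR
      simp only [P', if_pos hsR, if_pos hsR']
      exact mul_le_mul_of_nonneg_left hle (by linarith)
    · simp only [P', if_neg hsR]
      exact hle.trans (hPP' _)
  · set w := Real.log x with hw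
    have hw0 : 0 ≤ w := Real.log_nonneg hx1
    have hwm : w ≤ Real.log (xMax (Agent n)) := Real.log_le_log (by linarith) hxm
    -- Blocks are classified by their price before the update; crossing the target within the
    -- iteration can only lower the gain.
    have hterm : ∀ k : ℕ, phase ((k + 1) * Real.log U) (Real.log (P' k)) ≤
        phase ((k + 1) * Real.log U) (Real.log (P k)) +
          ((if Rises G k ∧ P k < (U : ℝ) ^ (k + 1) then w else 0) -
            3 * if Rises G k ∧ ¬ P k < (U : ℝ) ^ (k + 1) then w else 0) := by
      intro k
      by_cases hR : Rises G k
      · have hlog : Real.log (P' k) = w + Real.log (P k) := by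
          simp only [P', if_pos hR]
          exact Real.log_mul (by linarith) (hP0 k).ne'
        rw [hlog]
        by_cases hF : P k < (U : ℝ) ^ (k + 1)
        · simp only [hR, hF, true_and, if_true, not_true_eq_false, if_false, mul_zero, sub_zero]
          exact phase_add_le hw0
        · simp only [hR, hF, true_and, if_true, not_false_eq_true, if_false]
          rw [lt_pow_iff_log_lt hU (hP0 k), not_lt] at hF
          rw [phase_add_of_le hw0 hF]
          linarith
      · simp only [P', hR, if_false, false_and]
        simp
    have hsum := Finset.sum_le_sum fun k (_ : k ∈ Finset.range (blocks n).card) => hterm k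
    rw [Finset.sum_add_distrib, Finset.sum_sub_distrib, ← Finset.mul_sum, ← Finset.sum_filter,
      ← Finset.sum_filter, Finset.sum_const, Finset.sum_const, nsmul_eq_mul, nsmul_eq_mul] at hsum
    have hcard := card_rises_le hU h hf hr G rfl
    have hcard' : (((Finset.range (blocks n).card).filter fun k =>
        Rises G k ∧ P k < (U : ℝ) ^ (k + 1)).card : ℝ) ≤
        1 + 3 * ((Finset.range (blocks n).card).filter fun k =>
          Rises G k ∧ ¬ P k < (U : ℝ) ^ (k + 1)).card := by exact_mod_cast hcard
    have := mul_le_mul_of_nonneg_right hcard' hw0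
    unfold potential
    linarith

theorem Inv.init (hU : 2 ≤ U) {p : Agent n → ℝ} (hp : ∀ j, p j = 1) :
    Inv n U (fun _ => 1) p := by
  classical
  have hprice : p = blockPrice n fun _ => 1 := by
    funext j
    rw [hp]
    rcases j with a | k
    · simp [blockPrice]
    · rfl
  -- Initially each owner of a good that is not low-demand buys its own good, and low-demand owners
  -- buy nothing.
  refine ⟨hprice, fun _ => le_rfl,
    ⟨fun i j => if i = j ∧ NotLow j then 1 else 0, ⟨fun i j => ?_, fun i j hij => ?_, fun i => ?_,
      fun j => ?_⟩, fun j hj => ?_⟩, fun _ _ _ _ => le_rfl⟩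
  · split_ifs <;> norm_num
  · refine if_neg ?_
    rintro ⟨rfl, hi⟩
    refine hij fun k => ?_
    rw [hp, hp, div_one, div_one]
    norm_cast
    rcases i with a | l
    · rw [utility_own rfl hi]
      rcases k with k | k <;> simp only [utility] <;> split_ifs <;> omega
    · rcases k with k | k <;> simp only [utility] <;> split_ifs <;> omega
  · rw [hp, Finset.sum_eq_single i]
    · split_ifs <;> norm_num
    · exact fun j _ hj => if_neg fun h => hj h.1.symm
    · exact fun h => absurd (Finset.mem_univ _) h
  · rw [hp, Finset.sum_eq_single j]
    · split_ifs <;> norm_num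
    · exact fun i _ hi => if_neg fun h => hi h.1
    · exact fun h => absurd (Finset.mem_univ _) h
  · rw [hp, Finset.sum_eq_single j]
    · exact if_pos ⟨rfl, hj⟩
    · exact fun i _ hi => if_neg fun h => hi h.1
    · exact fun h => absurd (Finset.mem_univ _) h

/-- When the main loop is left, all prices have reached their target values. -/
theorem Inv.pow_le (hU : 2 ≤ U) (hn : 1 ≤ n) (h : Inv n U P p)
    (hf : IsBalanced (utility n U) p f) (hr : surplusNorm p f ≤ threshold (utility n U)) {k : ℕ}
    (hk : k < (blocks n).card) : (U : ℝ) ^ (k + 1) ≤ P k := by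
  by_contra! hlt
  obtain ⟨b, hb, rfl⟩ := exists_position_eq hk
  obtain ⟨a, ha, -⟩ := exists_high ⟨b, hb⟩
  have hab : (a.1 : ℕ × ℕ) = b := by rw [ha]
  have hs := h.surplus_eq hU hf a (by rw [hab]; exact hlt)
  have hle := (surplus_le_surplusNorm (p := p) (f := f) (.inl a)).trans hr
  rw [hs, hab] at hle
  obtain ⟨⟨hbn, -⟩, hbp, hb3, hb1, hb2⟩ := mem_blocks_iff.1 hb
  have hN1 : (1 : ℝ) ≤ Fintype.card (Agent n) := by exact_mod_cast one_le_card_agent hn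
  have hbN : (b.1 : ℝ) ≤ Fintype.card (Agent n) := by
    exact_mod_cast hbn.le.trans (le_card_agent n)
  have hb0 : (0 : ℝ) < b.1 := by exact_mod_cast hbp.pos
  have hratio : 1 / (Fintype.card (Agent n) : ℝ) ≤ ratio b := by
    have : (ratio b : ℝ) = ((b.1 : ℝ) - b.2) / b.1 := by simp [ratio]
    rw [this]
    have h1 : (1 : ℝ) ≤ (b.1 : ℝ) - b.2 := by
      have : (b.2 : ℝ) + 1 ≤ b.1 := by exact_mod_cast hb2
      linarith
    exact div_le_div₀ (by linarith) h1 hb0 hbN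
  have hmax : 1 ≤ maxUtility (utility n U) := by
    have h1 : utility n U (.inr ⟨0, hn⟩) (.inr ⟨0, hn⟩) = U := by simp [utility]
    have h2 : utility n U (.inr ⟨0, hn⟩) (.inr ⟨0, hn⟩) ≤ maxUtility (utility n U) :=
      (Finset.le_sup (f := fun j => utility n U (.inr ⟨0, hn⟩) j) (Finset.mem_univ _)).trans
        (Finset.le_sup (f := fun i => Finset.univ.sup fun j => utility n U i j)
          (Finset.mem_univ _))
    omega
  have hthr : threshold (utility n U) < 1 / (Fintype.card (Agent n) : ℝ) := by
    unfold threshold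
    refine one_div_lt_one_div_of_lt (by linarith) ?_
    have h1 : (Fintype.card (Agent n) : ℝ) ≤
        (Fintype.card (Agent n) : ℝ) ^ (4 * Fintype.card (Agent n)) :=
      le_self_pow₀ hN1 (by have := one_le_card_agent hn; omega)
    have h2 : (1 : ℝ) ≤ (maxUtility (utility n U) : ℝ) ^ (3 * Fintype.card (Agent n)) :=
      one_le_pow₀ (by exact_mod_cast hmax)
    nlinarith
  linarith

theorem Inv.potential_ge (hU : 2 ≤ U) (hn : 1 ≤ n) (h : Inv n U P p)
    (hpow : ∀ k < (blocks n).card, (U : ℝ) ^ (k + 1) ≤ P k) :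
    ((blocks n).card : ℝ) ^ 2 / 2 * Real.log U -
      3 * (blocks n).card * Real.log (Fintype.card (Agent n)) ≤ potential n U P := by
  have hU0 : (0 : ℝ) < U := by exact_mod_cast (by omega : 0 < U)
  have hlogU : 0 ≤ Real.log U := Real.log_natCast_nonneg U
  have hN1 : (1 : ℝ) ≤ Fintype.card (Agent n) := by exact_mod_cast one_le_card_agent hn
  obtain ⟨g, hg, hs⟩ := h.sold
  have hpr := h.price
  subst hpr
  have hterm : ∀ k ∈ Finset.range (blocks n).card,
      ((k : ℝ) + 1) * Real.log U - 3 * Real.log (Fintype.card (Agent n)) ≤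
        phase ((k + 1) * Real.log U) (Real.log (P k)) := by
    intro k hk
    have hk := Finset.mem_range.1 hk
    have hPk : 0 < P k := zero_lt_one.trans_le (h.one_le k)
    have h1 : ((k : ℝ) + 1) * Real.log U ≤ Real.log (P k) := by
      have := (lt_pow_iff_log_lt hU hPk).not.1 (hpow k hk).not_gt
      exact not_lt.1 this
    have h2 : Real.log (P k) ≤ Real.log (Fintype.card (Agent n)) + (k + 1) * Real.log U := by
      have := Real.log_le_log hPk (price_le_pow hU h.one_le hg hs hn hk)
      rw [Real.log_mul (by linarith) (by positivity), Real.log_pow] at this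
      push_cast at this
      exact this
    unfold phase
    rw [min_eq_right h1, max_eq_left (by linarith)]
    linarith
  refine le_trans ?_ (Finset.sum_le_sum hterm)
  rw [Finset.sum_sub_distrib, ← Finset.sum_mul, Finset.sum_const, Finset.card_range, nsmul_eq_mul]
  have hgauss : ((blocks n).card : ℝ) ^ 2 / 2 ≤ ∑ k ∈ Finset.range (blocks n).card, ((k : ℝ) + 1) := by
    generalize (blocks n).card = m
    induction m with
    | zero => simp
    | succ m ih =>
      rw [Finset.sum_range_succ]
      push_cast
      nlinarith
  have := mul_le_mul_of_nonneg_right hgauss hlogU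
  linarith

theorem potential_one (n U : ℕ) : potential n U (fun _ => 1) = 0 := by
  refine Finset.sum_eq_zero fun k _ => ?_
  have : 0 ≤ ((k : ℝ) + 1) * Real.log U :=
    mul_nonneg (by positivity) (Real.log_natCast_nonneg U)
  rw [phase, Real.log_one, min_eq_left this, max_eq_right (by linarith)]
  norm_num

theorem log_xMax_le (hn : 1 ≤ n) : Real.log (xMax (Agent n)) ≤ 1 / (n : ℝ) ^ 3 := by
  have hn0 : (1 : ℝ) ≤ n := by exact_mod_cast hn
  have hN : (n : ℝ) ≤ Fintype.card (Agent n) := by exact_mod_cast le_card_agent n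
  have h1 : (n : ℝ) ^ 3 ≤ 8 * Real.exp 1 ^ 2 * (Fintype.card (Agent n) : ℝ) ^ 3 := by
    have h2 : (n : ℝ) ^ 3 ≤ (Fintype.card (Agent n) : ℝ) ^ 3 :=
      pow_le_pow_left₀ (by linarith) hN 3
    have h3 : (1 : ℝ) ≤ Real.exp 1 := Real.one_le_exp (by norm_num)
    have h4 : (1 : ℝ) ≤ Real.exp 1 ^ 2 := one_le_pow₀ h3
    nlinarith [pow_pos (by linarith : (0 : ℝ) < n) 3]
  have hpos : 0 < xMax (Agent n) := by unfold xMax; positivity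
  refine (Real.log_le_sub_one_of_pos hpos).trans ?_
  unfold xMax
  rw [add_sub_cancel_left]
  exact one_div_le_one_div_of_le (by positivity) h1

/-- A lower bound on the number of iterations of a run that leaves the main loop. -/
theorem le_iterations (hU : 2 ≤ U) (hn : 1 ≤ n) {p : ℕ → Agent n → ℝ}
    {f : ℕ → Agent n → Agent n → ℝ} (hrun : IsRun (utility n U) p f) {t : ℕ}
    (ht : surplusNorm (p t) (f t) ≤ threshold (utility n U)) :
    (n : ℝ) ^ 3 * (((blocks n).card : ℝ) ^ 2 / 2 * Real.log U -
      3 * (blocks n).card * Real.log (Fintype.card (Agent n))) ≤ t := by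
  classical
  -- The argument is run up to the first exit time, since later prices are unconstrained.
  have hex : ∃ t, surplusNorm (p t) (f t) ≤ threshold (utility n U) := ⟨t, ht⟩
  set T := Nat.find hex with hT
  have hTt : T ≤ t := Nat.find_min' hex ht
  have hinv : ∀ s ≤ T, ∃ P, Inv n U P (p s) ∧
      potential n U P ≤ s * Real.log (xMax (Agent n)) := by
    intro s
    induction s with
    | zero => exact fun _ => ⟨_, Inv.init hU hrun.init, by simp [potential_one]⟩
    | succ s ih =>
      intro hs
      obtain ⟨P, hP, hpot⟩ := ih (by omega)
      have hlt := not_le.1 (Nat.find_min hex (by omega : s < T))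
      obtain ⟨P', hP', hpot'⟩ :=
        hP.step hU (hrun.balanced s) ((threshold_nonneg _).trans_lt hlt)
      rw [← hrun.step s hlt] at hP'
      refine ⟨P', hP', ?_⟩
      push_cast
      linarith
  obtain ⟨P, hP, hpot⟩ := hinv T le_rfl
  have hge := hP.potential_ge hU hn fun k hk =>
    hP.pow_le hU hn (hrun.balanced T) (Nat.find_spec hex) hk
  have hn0 : (0 : ℝ) < (n : ℝ) ^ 3 := by
    have : (0 : ℝ) < n := by exact_mod_cast hn
    positivity
  have h1 : (T : ℝ) * Real.log (xMax (Agent n)) ≤ T * (1 / (n : ℝ) ^ 3) :=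
    mul_le_mul_of_nonneg_left (log_xMax_le hn) (Nat.cast_nonneg _)
  have h2 := mul_le_mul_of_nonneg_left ((hge.trans hpot).trans h1) hn0.le
  have h3 : (n : ℝ) ^ 3 * (T * (1 / (n : ℝ) ^ 3)) = T := by field_simp
  have h4 : (T : ℝ) ≤ t := by exact_mod_cast hTt
  linarith

end Step

/-! ### Number of agents and number of blocks -/

section Counting

open Filter

theorem card_agent_le {n : ℕ} (hn : 2 ≤ n) : Fintype.card (Agent n) ≤ n ^ 4 := by
  rw [Fintype.card_sum, Fintype.card_fin, Fintype.card_sigma]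
  simp only [Fintype.card_fin]
  have h1 : ∑ b : {b : ℕ × ℕ // b ∈ blocks n}, b.1.1 ≤ ∑ _b : {b : ℕ × ℕ // b ∈ blocks n}, n :=
    Finset.sum_le_sum fun b _ => (mem_blocks_iff.1 b.2).1.1.le
  have h2 : (blocks n).card ≤ n * n := by
    refine (Finset.card_filter_le _ _).trans ?_
    rw [Finset.card_product, Finset.card_range]
  rw [Finset.sum_const, Finset.card_univ, Fintype.card_coe, smul_eq_mul] at h1
  calc _ ≤ n * n * n + n := by gcongr; exact h1.trans (Nat.mul_le_mul_right n h2)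
    _ ≤ n * n * n * 2 := by nlinarith [Nat.mul_le_mul hn hn]
    _ ≤ n * n * n * n := Nat.mul_le_mul_left _ hn
    _ = n ^ 4 := by ring

/-- Only blocks with `j` prime as well are counted, each giving two ordered pairs of distinct
primes. The logarithmic factor lost this way is affordable because of the `log⁴ n` in the theorem.
-/
theorem primeCounting_sq_le_card_blocks {n K : ℕ} (hn : 1 ≤ n) (hK : (K : ℝ) < (n : ℝ) ^ (1 / 3 : ℝ)) :
    K.primeCounting * K.primeCounting ≤ 2 * (blocks n).card + K.primeCounting := by
  set Q := Nat.primesLE K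
  have hsub : Q.offDiag ⊆ blocks n ∪ (blocks n).image Prod.swap := by
    have hKn : K < n := by
      have h1 : (n : ℝ) ^ (1 / 3 : ℝ) ≤ n :=
        (Real.rpow_le_rpow_of_exponent_le (by exact_mod_cast hn) (by norm_num)).trans_eq
          (Real.rpow_one _)
      exact_mod_cast hK.trans_le h1
    have main : ∀ i j, i ∈ Q → j ∈ Q → j < i → (i, j) ∈ blocks n := by
      intro i j hi hj hij
      have hi' := Nat.mem_primesLE.1 hi
      have hj' := Nat.mem_primesLE.1 hj
      refine mem_blocks_iff.2 ⟨⟨?_, ?_⟩, hi'.2, ?_, hj'.2.one_le, hij⟩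
      · exact hi'.1.trans_lt hKn
      · exact hj'.1.trans_lt hKn
      · exact lt_of_le_of_lt (by exact_mod_cast hi'.1) hK
    rintro ⟨i, j⟩ h
    obtain ⟨hi, hj, hne⟩ := Finset.mem_offDiag.1 h
    rcases lt_or_gt_of_ne hne with hlt | hlt
    · exact Finset.mem_union_right _ (Finset.mem_image.2 ⟨(j, i), main j i hj hi hlt, rfl⟩)
    · exact Finset.mem_union_left _ (main i j hi hj hlt)
  have hcard := (Finset.card_le_card hsub).trans
    ((Finset.card_union_le _ _).trans (Nat.add_le_add_left Finset.card_image_le _))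
  rw [Finset.offDiag_card, Nat.primesLE_card_eq_primeCounting] at hcard
  omega

theorem eventually_le_primeCounting :
    ∀ᶠ K : ℕ in atTop, (K : ℝ) / (4 * Real.log K) ≤ K.primeCounting := by
  have h1 : ∀ᶠ x : ℝ in atTop, Real.log x ≤ Real.log 2 / 8 * x := by
    filter_upwards [Real.isLittleO_log_id_atTop.bound (c := Real.log 2 / 8)
      (by have := Real.log_pos one_lt_two; positivity), eventually_ge_atTop 1] with x hx hx1
    rwa [Real.norm_of_nonneg (Real.log_nonneg hx1), id, Real.norm_of_nonneg (by linarith)] at hx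
  have h2 : Tendsto (fun K : ℕ => (K : ℝ) + 1) atTop atTop :=
    tendsto_atTop_add_const_right _ _ tendsto_natCast_atTop_atTop
  filter_upwards [h2.eventually h1, eventually_ge_atTop 2] with K hK hK2
  have hK2' : (2 : ℝ) ≤ K := by exact_mod_cast hK2
  have hlog : 0 < Real.log K := Real.log_pos (by linarith)
  refine le_trans ?_ (Chebyshev.pi_ge K)
  have := Real.log_two_gt_d9
  rw [← div_div]
  refine div_le_div_of_nonneg_right ?_ hlog.le
  nlinarith

theorem eventually_le_card_blocks :
    ∀ᶠ n : ℕ in atTop, ((n : ℝ) ^ (1 / 3 : ℝ)) ^ 2 / (1024 * Real.log n ^ 2) ≤ (blocks n).card ∧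
      100 * Real.log n ≤ (blocks n).card := by
  have hz : Tendsto (fun n : ℕ => (n : ℝ) ^ (1 / 3 : ℝ)) atTop atTop :=
    (tendsto_rpow_atTop (by norm_num)).comp tendsto_natCast_atTop_atTop
  -- Halving makes the prime bound strictly smaller than `n^(1/3)`.
  have hK : Tendsto (fun n : ℕ => ⌊(n : ℝ) ^ (1 / 3 : ℝ) / 2⌋₊) atTop atTop :=
    tendsto_nat_floor_atTop.comp (hz.atTop_div_const two_pos)
  have hlog3 : ∀ᶠ z : ℝ in atTop, Real.log z ^ 3 ≤ 1 / 10000000 * z := by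
    filter_upwards [(Real.isLittleO_pow_log_id_atTop (n := 3)).bound
      (c := 1 / 10000000) (by norm_num), eventually_ge_atTop 1] with z hz hz1
    rwa [Real.norm_of_nonneg (pow_nonneg (Real.log_nonneg hz1) 3), id,
      Real.norm_of_nonneg (by linarith)] at hz
  filter_upwards [hK.eventually eventually_le_primeCounting, hK.eventually_ge_atTop 2,
    hz.eventually hlog3, hz.eventually_ge_atTop 4, eventually_ge_atTop 2,
    (Real.tendsto_log_atTop.comp hz).eventually_ge_atTop 1] with n hπ hK2 hl3 hz4 hn2 hl1
  set z := (n : ℝ) ^ (1 / 3 : ℝ) with hzdef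
  set K := ⌊z / 2⌋₊
  simp only [Function.comp_apply, ← hzdef] at hl1
  have hn0 : (0 : ℝ) < n := by exact_mod_cast (by omega : 0 < n)
  have hlogn : Real.log n = 3 * Real.log z := by
    rw [hzdef, Real.log_rpow hn0]; ring
  have hKle : (K : ℝ) ≤ z / 2 := Nat.floor_le (by linarith)
  have hKge : z / 4 ≤ K := by
    have := Nat.lt_floor_add_one (z / 2)
    linarith
  have hK2' : (2 : ℝ) ≤ K := by exact_mod_cast hK2
  have hlogK : Real.log K ≤ Real.log n := by
    rw [hlogn]
    have : Real.log K ≤ Real.log z := Real.log_le_log (by linarith) (by linarith)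
    linarith
  have hlogK0 : 0 < Real.log K := Real.log_pos (by linarith)
  have hcount := primeCounting_sq_le_card_blocks (n := n) (K := K) (by omega) (by linarith)
  have hcount' : (K.primeCounting : ℝ) * K.primeCounting ≤ 2 * (blocks n).card + K.primeCounting := by
    exact_mod_cast hcount
  have hπ' : z / (16 * Real.log n) ≤ K.primeCounting := by
    refine le_trans ?_ hπ
    rw [div_le_div_iff₀ (by linarith) (by linarith)]
    nlinarith
  have hy0 : 0 < z / (16 * Real.log n) := by
    have : 0 < Real.log n := by linarith
    positivity
  have hy : z / (16 * Real.log n) = z / (48 * Real.log z) := by rw [hlogn]; ring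
  have hlz : Real.log z ≤ Real.log z ^ 3 := le_self_pow₀ hl1 (by norm_num)
  have hy2 : 2 ≤ z / (16 * Real.log n) := by
    rw [hy, le_div_iff₀ (by linarith)]
    linarith
  -- With `π ≥ 2`, half of `π² - π` is at least `π² / 4`; this gives `1024 = 4 · 16²`.
  have hm : (z / (16 * Real.log n)) ^ 2 / 4 ≤ (blocks n).card := by nlinarith
  have heq : (z / (16 * Real.log n)) ^ 2 / 4 = z ^ 2 / (1024 * Real.log n ^ 2) := by
    rw [div_pow, mul_pow, div_div]
    ring_nf
  refine ⟨heq ▸ hm, le_trans ?_ (heq ▸ hm)⟩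
  rw [hlogn, le_div_iff₀ (by positivity)]
  have : Real.log z ^ 3 * z ≤ 1 / 10000000 * z * z := mul_le_mul_of_nonneg_right hl3 (by linarith)
  nlinarith [pow_pos (by linarith : 0 < Real.log z) 3]

end Counting

end DuanMehlhorn

/-! ### Assembling the bound -/

theorem mainTheorem7 :
    ∃ c : ℝ, 0 < c ∧ ∃ n₀ : ℕ, ∀ n U : ℕ, n₀ ≤ n → 1 ≤ U →
      ∀ (p : ℕ → DuanMehlhorn.Agent n → ℝ)
        (f : ℕ → DuanMehlhorn.Agent n → DuanMehlhorn.Agent n → ℝ),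
        DuanMehlhorn.IsRun (DuanMehlhorn.utility n U) p f →
          ENNReal.ofReal
              (c * ((n : ℝ) ^ (4 + 1 / 3 : ℝ) * Real.log (U : ℝ) / Real.log (n : ℝ) ^ 4)) ≤
            ((DuanMehlhorn.iterations (DuanMehlhorn.utility n U) p f : ℕ∞) : ENNReal) := by
  obtain ⟨n₁, hn₁⟩ := Filter.eventually_atTop.1 DuanMehlhorn.eventually_le_card_blocks
  -- `4194304 = 4 · 1024²`: the factor `1 / 1024` in the block count is squared, and half of `m² / 2
  -- · log U` is given up.
  refine ⟨1 / 4194304, by norm_num, max n₁ 2, fun n U hn hU p f hrun => ?_⟩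
  -- For `U = 1` the bound is zero.
  rcases hU.eq_or_lt with rfl | hU
  · simp
  have hn2 : 2 ≤ n := (le_max_right _ _).trans hn
  obtain ⟨hm1, hm2⟩ := hn₁ n ((le_max_left _ _).trans hn)
  set X := 1 / 4194304 * ((n : ℝ) ^ (4 + 1 / 3 : ℝ) * Real.log (U : ℝ) / Real.log (n : ℝ) ^ 4)
    with hX
  have hceil : ((⌈X⌉₊ : ℕ) : ℕ∞) ≤
      DuanMehlhorn.iterations (DuanMehlhorn.utility n U) p f := by
    -- A run that never stops is covered as well: its infimum is over the empty set.
    refine le_iInf₂ fun t ht => ?_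
    have hle := DuanMehlhorn.le_iterations hU (by omega) hrun ht
    rw [Nat.cast_le, Nat.ceil_le]
    refine le_trans ?_ hle
    set m : ℝ := ((DuanMehlhorn.blocks n).card : ℝ) with hm
    have hn0 : (0 : ℝ) < n := by exact_mod_cast (by omega : 0 < n)
    have hlogn : 0 < Real.log n := Real.log_pos (by exact_mod_cast (by omega : 1 < n))
    have hlogU : Real.log 2 ≤ Real.log U := Real.log_le_log two_pos (by exact_mod_cast hU)
    have hlog2 := Real.log_two_gt_d9
    have hlogN : Real.log (Fintype.card (DuanMehlhorn.Agent n)) ≤ 4 * Real.log n := by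
      have h1 : (0 : ℝ) < Fintype.card (DuanMehlhorn.Agent n) := by
        exact_mod_cast DuanMehlhorn.one_le_card_agent (by omega)
      have h2 : (Fintype.card (DuanMehlhorn.Agent n) : ℝ) ≤ (n : ℝ) ^ 4 := by
        exact_mod_cast DuanMehlhorn.card_agent_le hn2
      refine (Real.log_le_log h1 h2).trans_eq ?_
      rw [Real.log_pow]
      norm_num
    have hm0 : 0 ≤ m := Nat.cast_nonneg _
    -- Here `m ≥ 100 log n`, `log N ≤ 4 log n` and `log U ≥ log 2` make the overshoot term at most
    -- half of the main term.
    have hmain : m ^ 2 / 4 * Real.log U ≤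
        m ^ 2 / 2 * Real.log U - 3 * m * Real.log (Fintype.card (DuanMehlhorn.Agent n)) := by
      have h1 : m * Real.log (Fintype.card (DuanMehlhorn.Agent n)) ≤ m * (m * (Real.log U / 12)) := by
        refine mul_le_mul_of_nonneg_left ?_ hm0
        nlinarith
      nlinarith
    have hpow : (n : ℝ) ^ (4 + 1 / 3 : ℝ) = (n : ℝ) ^ 3 * (((n : ℝ) ^ (1 / 3 : ℝ)) ^ 2) ^ 2 := by
      rw [← pow_mul, ← Real.rpow_natCast, ← Real.rpow_natCast, ← Real.rpow_mul hn0.le,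
        ← Real.rpow_add hn0]
      norm_num
    have hsq : (((n : ℝ) ^ (1 / 3 : ℝ)) ^ 2 / (1024 * Real.log n ^ 2)) ^ 2 ≤ m ^ 2 :=
      pow_le_pow_left₀ (by positivity) hm1 2
    calc X = (n : ℝ) ^ 3 * ((((n : ℝ) ^ (1 / 3 : ℝ)) ^ 2 / (1024 * Real.log n ^ 2)) ^ 2 / 4 *
          Real.log U) := by
          rw [hX, hpow]
          field_simp
          ring
      _ ≤ (n : ℝ) ^ 3 * (m ^ 2 / 4 * Real.log U) := by
          have : 0 ≤ Real.log U := by linarith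
          gcongr
      _ ≤ _ := mul_le_mul_of_nonneg_left hmain (by positivity)
  calc ENNReal.ofReal X ≤ ENNReal.ofReal (⌈X⌉₊ : ℝ) := ENNReal.ofReal_le_ofReal (Nat.le_ceil X)
    _ = (((⌈X⌉₊ : ℕ) : ℕ∞) : ENNReal) := by rw [ENNReal.ofReal_natCast]; rfl
    _ ≤ _ := by exact_mod_cast hceil
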